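/- Let $(M,g)$ be a smooth Riemannian manifold of dimension $n$ (without boundary, Hausdorff, second countable), let $f:M\to\mathbb R$, and let $\rho=e^{-f}\sqrt{\det g}$ be the associated density on $M$. Let $V\to M$ be a smooth real vector bundle of finite rank with a smooth bundle metric $\langle\cdot,\cdot\rangle$ (for example $V=TM$ with $g$), and let $\nabla$ be a smooth connection on $V$. Let $\tilde\nabla$ be its dual connection, defined by $X\langle\sigma,\tau\rangle=\langle\nabla_X\sigma,\tau\rangle+\langle\sigma,\tilde\nabla_X\tau\rangle$, and let $K_X\sigma=\tilde\nabla_X\sigma-\nabla_X\sigma$ be the difference tensor. Let $\nabla^*:\Gamma(T^*M\otimes V)\to\Gamma(V)$ be the formal adjoint of $\nabla:\Gamma(V)\to\Gamma(T^*M\otimes V)$ with respect to $\rho$, that is, $$\int_M\langle\eta,\nabla Y\rangle\,\rho=\int_M\langle\nabla^*\eta,Y\rangle\,\rho$$ for all smooth $\eta\in\Gamma(T^*M\otimes V)$ and all compactly supported smooth $Y\in\Gamma(V)$, and let $\Delta=\nabla^*\nabla$ be the Bochner Laplacian. Suppose that $\nabla$ is compatible with the metric, i.e. $X\langle\sigma,\tau\rangle=\langle\nabla_X\sigma,\tau\rangle+\langle\sigma,\nabla_X\tau\rangle$,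 and that $f=0$. Then: 1. $\tilde\nabla=\nabla$ and $K=0$. 2. The formal adjoint $\nabla^*$ exists, and for every smooth section $X$ of $V$ the Bochner Laplacian is given in every smooth chart by $$\Delta X=-g^{ij}\tilde\nabla_j\nabla_iX-\frac{1}{\sqrt{\det g}}\,\partial_j\!\left(\sqrt{\det g}\,g^{ij}\right)\nabla_iX+g^{ij}\,\partial_jf\,\nabla_iX .$$ 3. $\Delta$ coincides with the connection Laplacian of Riemannian geometry: for every smooth section $X$ of $V$, $$\Delta X=-\operatorname{tr}_g\nabla^2X,\qquad \nabla^2_{U,W}X=\nabla_U\nabla_WX-\nabla_{\nabla^g_UW}X,$$ where $\nabla^g$ is the Levi-Civita connection of $g$. In particular, if $V=TM$ with the metric $g$ and $\nabla$ is torsion-free, then $\nabla=\nabla^g$ and this is the usual connection Laplacian on vector fields. -/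

import Mathlib

open Bundle Set MeasureTheory Filter Topology
open scoped Manifold ContDiff ENNReal

noncomputable section

namespace BochnerLaplacian

/-! ### Local coordinates, the metric in coordinates, and the density `ρ = e^{-f} √(det g)` -/

section Coordinates

variable {n : ℕ} {M : Type*} [TopologicalSpace M] [ChartedSpace (EuclideanSpace ℝ (Fin n)) M]

/-- The coordinate vector field `∂ᵢ` of a chart `e`: the pullback under `e` of the `i`-th constant
standard basis field of `ℝⁿ`. (It is meaningful on `e.source`.) -/
def coordField (e : OpenPartialHomeomorph M (EuclideanSpace ℝ (Fin n))) (i : Fin n) (p : M) :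
    TangentSpace (𝓡 n) p :=
  VectorField.mpullback (𝓡 n) (𝓡 n) e
    (fun y => (NormedSpace.fromTangentSpace y).symm (EuclideanSpace.single i (1 : ℝ))) p

/-- The partial derivative `∂ⱼ u` at `p` of a real function `u` on `M`, in the chart `e`. -/
def coordDeriv (e : OpenPartialHomeomorph M (EuclideanSpace ℝ (Fin n))) (j : Fin n)
    (u : M → ℝ) (p : M) : ℝ :=
  mvfderiv (𝓡 n) u p (coordField e j p)

variable [RiemannianBundle (fun x : M => TangentSpace (𝓡 n) x)]

/-- The matrix `(g_{ij})` of the metric in the chart `e`. Its inverse is `(g^{ij})`. -/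
def gramMatrix (e : OpenPartialHomeomorph M (EuclideanSpace ℝ (Fin n))) (p : M) :
    Matrix (Fin n) (Fin n) ℝ :=
  Matrix.of fun i j => inner ℝ (coordField e i p) (coordField e j p)

/-- `√(det g)` in the chart `e`. -/
def sqrtDet (e : OpenPartialHomeomorph M (EuclideanSpace ℝ (Fin n))) (p : M) : ℝ :=
  Real.sqrt (gramMatrix e p).det

/-- The measure `e^{-f} √(det g) dx¹ ⋯ dxⁿ` on the domain of the chart `e`, extended by zero to
the whole of `M`. -/
def chartMeasure [MeasurableSpace M] (f : M → ℝ)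
    (e : OpenPartialHomeomorph M (EuclideanSpace ℝ (Fin n))) : Measure M :=
  Measure.map e.symm ((volume.restrict e.target).withDensity fun y =>
    ENNReal.ofReal (Real.exp (-f (e.symm y)) * sqrtDet e (e.symm y)))

/-- The measure on `M` with density `ρ = e^{-f} √(det g)`. By the change of variables formula the
chart measures agree on overlaps of chart domains; their supremum in the lattice of measures is the
measure on `M` which restricts to each of them on the respective chart domain. -/
def densityMeasure (n : ℕ) (M : Type*) [TopologicalSpace M]
    [ChartedSpace (EuclideanSpace ℝ (Fin n)) M]
    [RiemannianBundle (fun x : M => TangentSpace (𝓡 n) x)] [MeasurableSpace M]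
    (f : M → ℝ) : Measure M :=
  ⨆ e ∈ IsManifold.maximalAtlas (𝓡 n) ∞ M, chartMeasure f e

end Coordinates

/-! ### Connections -/

section Connections

variable {n : ℕ} {M : Type*} [TopologicalSpace M] [ChartedSpace (EuclideanSpace ℝ (Fin n)) M]
  {F : Type*} [NormedAddCommGroup F] [NormedSpace ℝ F]
  {V : M → Type*} [TopologicalSpace (TotalSpace F V)]
  [∀ x, NormedAddCommGroup (V x)] [∀ x, InnerProductSpace ℝ (V x)] [FiberBundle F V]

/-- The connection `cov'` is dual to `cov`:
`X⟨σ, τ⟩ = ⟨∇_X σ, τ⟩ + ⟨σ, ∇'_X τ⟩` for all tangent vectors `X` and all sections `σ`, `τ`. -/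
def IsDual (cov cov' : CovariantDerivative (𝓡 n) F V) : Prop :=
  ∀ (x : M) (X : TangentSpace (𝓡 n) x) (σ τ : Π y : M, V y),
    MDifferentiableAt (𝓡 n) ((𝓡 n).prod 𝓘(ℝ, F)) (fun y => TotalSpace.mk' F y (σ y)) x →
    MDifferentiableAt (𝓡 n) ((𝓡 n).prod 𝓘(ℝ, F)) (fun y => TotalSpace.mk' F y (τ y)) x →
    mvfderiv (𝓡 n) (fun y => inner ℝ (σ y) (τ y)) x X =
      inner ℝ (cov σ x X) (τ x) + inner ℝ (σ x) (cov' τ x X)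

/-- `σ` is a smooth section of `V`. -/
def SmoothSection (σ : Π x : M, V x) : Prop :=
  ContMDiff (𝓡 n) ((𝓡 n).prod 𝓘(ℝ, F)) ∞ (fun x => TotalSpace.mk' F x (σ x))

/-- `η` is a smooth section of `T*M ⊗ V = Hom(TM, V)`. -/
def SmoothOneForm [IsManifold (𝓡 n) 1 M] [VectorBundle ℝ F V]
    (η : Π x : M, TangentSpace (𝓡 n) x →L[ℝ] V x) : Prop :=
  ContMDiff (𝓡 n) ((𝓡 n).prod 𝓘(ℝ, EuclideanSpace ℝ (Fin n) →L[ℝ] F)) ∞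
    (fun x => TotalSpace.mk' (EuclideanSpace ℝ (Fin n) →L[ℝ] F)
      (E := fun y : M => TangentSpace (𝓡 n) y →L[ℝ] V y) x (η x))

variable [RiemannianBundle (fun x : M => TangentSpace (𝓡 n) x)]

instance instFiniteDimensionalTangentSpace (x : M) :
    FiniteDimensional ℝ (TangentSpace (𝓡 n) x) :=
  inferInstanceAs (FiniteDimensional ℝ (EuclideanSpace ℝ (Fin n)))

/-- The inner product on the fibre of `T*M ⊗ V = Hom(TM, V)` at `x` induced by the two metrics. -/
def formInner (x : M) (A B : TangentSpace (𝓡 n) x →L[ℝ] V x) : ℝ :=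
  ∑ i, inner ℝ (A (stdOrthonormalBasis ℝ (TangentSpace (𝓡 n) x) i))
    (B (stdOrthonormalBasis ℝ (TangentSpace (𝓡 n) x) i))

/-- `D` is the formal adjoint `∇* : Γ(T*M ⊗ V) → Γ(V)` of the connection `∇ : Γ(V) → Γ(T*M ⊗ V)`
with respect to the density `ρ = e^{-f} √(det g)`. -/
structure IsFormalAdjoint [IsManifold (𝓡 n) 1 M] [VectorBundle ℝ F V] [MeasurableSpace M]
    (f : M → ℝ) (cov : CovariantDerivative (𝓡 n) F V)
    (D : (Π x : M, TangentSpace (𝓡 n) x →L[ℝ] V x) → Π x : M, V x) : Prop where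
  smooth : ∀ η, SmoothOneForm (F := F) η → SmoothSection (n := n) (F := F) (D η)
  adjoint : ∀ η, SmoothOneForm (F := F) η →
    ∀ Y : Π x : M, V x, SmoothSection (n := n) (F := F) Y →
      (∃ K : Set M, IsCompact K ∧ ∀ x ∉ K, Y x = 0) →
      ∫ x, formInner x (η x) (cov Y x) ∂(densityMeasure n M f) =
        ∫ x, inner ℝ (D η x) (Y x) ∂(densityMeasure n M f)

/-- The right-hand side, in the chart `e`, of the coordinate formula
`ΔX = - g^{ij} ∇̃_j ∇_i X - (1/√det g) ∂_j(√det g g^{ij}) ∇_i X + g^{ij} ∂_j f ∇_i X`. -/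
def coordFormula (f : M → ℝ) (cov cov' : CovariantDerivative (𝓡 n) F V)
    (e : OpenPartialHomeomorph M (EuclideanSpace ℝ (Fin n))) (X : Π x : M, V x) (p : M) : V p :=
  -(∑ i, ∑ j, (gramMatrix e p)⁻¹ i j •
      cov' (fun q => cov X q (coordField e i q)) p (coordField e j p))
  - ∑ i, ∑ j, ((1 / sqrtDet e p) *
      coordDeriv e j (fun q => sqrtDet e q * (gramMatrix e q)⁻¹ i j) p) •
        cov X p (coordField e i p)
  + ∑ i, ∑ j, ((gramMatrix e p)⁻¹ i j * coordDeriv e j f p) • cov X p (coordField e i p)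

set_option synthInstance.maxHeartbeats 200000 in
/-- `lc` is the Levi-Civita connection of `(M, g)`: the torsion-free metric connection on `TM`. -/
def IsLeviCivita [IsManifold (𝓡 n) ∞ M]
    [IsContMDiffRiemannianBundle (𝓡 n) ∞ (EuclideanSpace ℝ (Fin n))
      (fun x : M => TangentSpace (𝓡 n) x)]
    (lc : CovariantDerivative (𝓡 n) (EuclideanSpace ℝ (Fin n))
      (fun x : M => TangentSpace (𝓡 n) x)) : Prop :=
  lc.torsion = 0 ∧ lc.IsMetricCompatible

/-- The second covariant derivative `∇²_{u,w} X = ∇_u ∇_W X - ∇_{∇ᵍ_u W} X` at `p`, where `W` is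
any vector field with `W p = w` (the value does not depend on it; Mathlib's local extension
of `w` is used). -/
def secondCovariantDerivative (cov : CovariantDerivative (𝓡 n) F V)
    [IsManifold (𝓡 n) 1 M]
    (lc : CovariantDerivative (𝓡 n) (EuclideanSpace ℝ (Fin n))
      (fun x : M => TangentSpace (𝓡 n) x))
    (X : Π x : M, V x) (p : M) (u w : TangentSpace (𝓡 n) p) : V p :=
  cov (fun q => cov X q (FiberBundle.extend (EuclideanSpace ℝ (Fin n)) w q)) p u
    - cov X p (lc (FiberBundle.extend (EuclideanSpace ℝ (Fin n)) w) p u)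

/-- The connection Laplacian of Riemannian geometry, `-tr_g ∇²X`: minus the trace of the second
covariant derivative, computed in an orthonormal basis of the tangent space. -/
def connectionLaplacian (cov : CovariantDerivative (𝓡 n) F V)
    [IsManifold (𝓡 n) 1 M]
    (lc : CovariantDerivative (𝓡 n) (EuclideanSpace ℝ (Fin n))
      (fun x : M => TangentSpace (𝓡 n) x))
    (X : Π x : M, V x) (p : M) : V p :=
  -∑ i, secondCovariantDerivative cov lc X p
    (stdOrthonormalBasis ℝ (TangentSpace (𝓡 n) p) i)
    (stdOrthonormalBasis ℝ (TangentSpace (𝓡 n) p) i)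

end Connections

end BochnerLaplacian

end

set_option linter.unusedSectionVars false

noncomputable section

namespace BochnerLaplacian

/-! ### Coordinate frames of a smooth chart. -/

section CoordinateFields

variable {n : ℕ} {M : Type*} [TopologicalSpace M] [ChartedSpace (EuclideanSpace ℝ (Fin n)) M]
  {e : OpenPartialHomeomorph M (EuclideanSpace ℝ (Fin n))} {p : M}

/-! Comparing the two product rules for `⟨σ, τ⟩` and using nondegeneracy of the metric shows that a
metric connection equals its dual on differentiable sections (`IsDual.eq`). For the Laplacian, the
candidate adjoint is `codifferential`: `δη = -tr_g ∇η`, where `∇η` is built from `∇` and the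
Levi-Civita connection. With this choice `δ(∇X)` is the connection Laplacian by definition, so three
points remain. Coordinates: a trace in an arbitrary basis is a contraction with `g^{ij}`, and the
contracted Christoffel symbols satisfy `g^{ab} Γ_{ab}^i = -(1/√det g) ∂_j(√det g g^{ij})`
(`sum_inv_gramMatrix_leviCivita`). Together they put `δ` in coordinate form (`codifferential_eq`),
which also shows that `δη` is smooth. Adjointness: by metric compatibility, `√det g (⟨η, ∇Y⟩ - ⟨δη,
Y⟩)` is the coordinate divergence of `√det g g^{ij} ⟨η_i, Y⟩` (`sum_coordDeriv_fluxDensity`). If `Y`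
has compact support in a chart, its integral vanishes; a partition of unity gives the general case
(`integral_divergence`). The supremum defining the density measure is usable because chart measures
agree on overlaps (`densityMeasure_apply`). Uniqueness: two adjoints are compared by pairing their
difference with itself, cut off by a bump function (`IsFormalAdjoint.eq`). Hence every formal
adjoint agrees with `δ` on `∇X`. -/

lemma mdifferentiable_of_mem_maximalAtlas (he : e ∈ IsManifold.maximalAtlas (𝓡 n) ∞ M) :
    e.MDifferentiable (𝓡 n) (𝓡 n) :=
  ⟨(contMDiffOn_of_mem_maximalAtlas he).mdifferentiableOn (by simp),
    (contMDiffOn_symm_of_mem_maximalAtlas he).mdifferentiableOn (by simp)⟩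

lemma isInvertible_mfderiv_of_mem_maximalAtlas (he : e ∈ IsManifold.maximalAtlas (𝓡 n) ∞ M)
    (hp : p ∈ e.source) : (mfderiv (𝓡 n) (𝓡 n) e p).IsInvertible :=
  ⟨(mdifferentiable_of_mem_maximalAtlas he).mfderiv hp, rfl⟩

lemma coordField_eq_inverse (i : Fin n) : coordField e i p = (mfderiv (𝓡 n) (𝓡 n) e p).inverse
    ((NormedSpace.fromTangentSpace (e p)).symm (EuclideanSpace.single i (1 : ℝ))) := rfl

lemma mfderiv_coordField (he : e ∈ IsManifold.maximalAtlas (𝓡 n) ∞ M) (hp : p ∈ e.source)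
    (i : Fin n) : mfderiv (𝓡 n) (𝓡 n) e p (coordField e i p) =
      (NormedSpace.fromTangentSpace (e p)).symm (EuclideanSpace.single i (1 : ℝ)) := by
  rw [coordField_eq_inverse]
  exact (isInvertible_mfderiv_of_mem_maximalAtlas he hp).self_apply_inverse _

/-- The coordinate vector fields of a smooth chart form a basis at each point of its domain. -/
def coordBasis (he : e ∈ IsManifold.maximalAtlas (𝓡 n) ∞ M) (hp : p ∈ e.source) :
    Module.Basis (Fin n) ℝ (TangentSpace (𝓡 n) p) :=
  (EuclideanSpace.basisFun (Fin n) ℝ).toBasis.map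
    (((mdifferentiable_of_mem_maximalAtlas he).mfderiv hp).toLinearEquiv.trans
      (NormedSpace.fromTangentSpace (e p)).toLinearEquiv).symm

lemma coordBasis_apply (he : e ∈ IsManifold.maximalAtlas (𝓡 n) ∞ M) (hp : p ∈ e.source)
    (i : Fin n) : coordBasis he hp i = coordField e i p := by
  rw [coordBasis, Module.Basis.map_apply, LinearEquiv.symm_apply_eq]
  change _ = NormedSpace.fromTangentSpace (e p) (mfderiv (𝓡 n) (𝓡 n) e p (coordField e i p))
  rw [mfderiv_coordField he hp]
  simp

/-- Near `p`, `u = (u ∘ e.symm) ∘ e`, and `de` sends `∂ⱼ` to the standard basis vector, so this is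
the chain rule. It moves all calculus to `ℝⁿ`. -/
lemma coordDeriv_eq_fderiv (he : e ∈ IsManifold.maximalAtlas (𝓡 n) ∞ M) (hp : p ∈ e.source)
    {u : M → ℝ} (hu : MDifferentiableAt (𝓡 n) 𝓘(ℝ, ℝ) u p) (j : Fin n) :
    coordDeriv e j u p = fderiv ℝ (u ∘ e.symm) (e p) (EuclideanSpace.single j 1) := by
  have hs : MDifferentiableAt (𝓡 n) (𝓡 n) e.symm (e p) :=
    (mdifferentiable_of_mem_maximalAtlas he).mdifferentiableAt_symm (e.map_source hp)
  have hu' : MDifferentiableAt (𝓡 n) 𝓘(ℝ, ℝ) u (e.symm (e p)) := by rwa [e.left_inv hp]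
  have h2 : MDifferentiableAt (𝓡 n) 𝓘(ℝ, ℝ) (u ∘ e.symm) (e p) := hu'.comp _ hs
  have h3 : mfderiv (𝓡 n) 𝓘(ℝ, ℝ) u p =
      (mfderiv (𝓡 n) 𝓘(ℝ, ℝ) (u ∘ e.symm) (e p)).comp (mfderiv (𝓡 n) (𝓡 n) e p) := by
    rw [← mfderiv_comp p h2 ((mdifferentiable_of_mem_maximalAtlas he).mdifferentiableAt hp)]
    refine Filter.EventuallyEq.mfderiv_eq ?_
    filter_upwards [e.open_source.mem_nhds hp] with q hq
    simp [e.left_inv hq]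
  have h4 : mfderiv (𝓡 n) 𝓘(ℝ, ℝ) (u ∘ e.symm) (e p) = fderiv ℝ (u ∘ e.symm) (e p) :=
    mfderiv_eq_fderiv
  have h5 := mfderiv_coordField he hp j
  change mfderiv (𝓡 n) 𝓘(ℝ, ℝ) u p (coordField e j p) = _
  rw [h3, h4]
  change fderiv ℝ (u ∘ e.symm) (e p) (mfderiv (𝓡 n) (𝓡 n) e p (coordField e j p)) = _
  rw [h5]
  rfl

variable [IsManifold (𝓡 n) ∞ M]

lemma contMDiffAt_coordField (he : e ∈ IsManifold.maximalAtlas (𝓡 n) ∞ M) (hp : p ∈ e.source)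
    (i : Fin n) : ContMDiffAt (𝓡 n) ((𝓡 n).prod 𝓘(ℝ, EuclideanSpace ℝ (Fin n))) ∞
      (fun q => TotalSpace.mk' (EuclideanSpace ℝ (Fin n)) q (coordField e i q)) p := by
  refine ContMDiffAt.mpullback_vectorField_preimage (n := ∞) ?_
    (contMDiffAt_of_mem_maximalAtlas he hp) (isInvertible_mfderiv_of_mem_maximalAtlas he hp) le_rfl
  rw [contMDiffAt_vectorSpace_iff_contDiffAt]
  exact contDiffAt_const

lemma mdifferentiableAt_coordField (he : e ∈ IsManifold.maximalAtlas (𝓡 n) ∞ M)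
    (hp : p ∈ e.source) (i : Fin n) :
    MDifferentiableAt (𝓡 n) ((𝓡 n).prod 𝓘(ℝ, EuclideanSpace ℝ (Fin n)))
      (fun q => TotalSpace.mk' (EuclideanSpace ℝ (Fin n)) q (coordField e i q)) p :=
  (contMDiffAt_coordField he hp i).mdifferentiableAt (by simp)

/-- Brackets commute with pullback, and constant fields have zero bracket. Combined with zero
torsion, this makes the Christoffel symbols symmetric. -/
lemma mlieBracket_coordField (he : e ∈ IsManifold.maximalAtlas (𝓡 n) ∞ M) (hp : p ∈ e.source)
    (i j : Fin n) :
    VectorField.mlieBracket (𝓡 n) (coordField e i) (coordField e j) p = 0 := by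
  have h : ∀ k : Fin n, MDifferentiableAt (𝓡 n) ((𝓡 n).prod 𝓘(ℝ, EuclideanSpace ℝ (Fin n)))
      (fun y => TotalSpace.mk' (EuclideanSpace ℝ (Fin n)) y
        ((NormedSpace.fromTangentSpace (𝕜 := ℝ) y).symm (EuclideanSpace.single k (1 : ℝ)))) (e p) := by
    intro k
    refine ContMDiffAt.mdifferentiableAt (n := ∞) ?_ (by simp)
    rw [contMDiffAt_vectorSpace_iff_contDiffAt]
    exact contDiffAt_const
  have h2 : minSmoothness ℝ 2 ≤ (∞ : WithTop ℕ∞) := by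
    rw [minSmoothness_of_isRCLikeNormedField]
    exact ENat.LEInfty.out
  have : IsManifold (𝓡 n) (minSmoothness ℝ 2) M := IsManifold.of_le h2
  have := VectorField.mpullback_mlieBracket (n := ∞) (h i) (h j)
    (contMDiffAt_of_mem_maximalAtlas he hp) h2
  refine this.symm.trans ?_
  rw [VectorField.mpullback_apply, ← VectorField.mlieBracketWithin_univ,
    VectorField.mlieBracketWithin_eq_lieBracketWithin]
  have h0 : VectorField.lieBracketWithin ℝ (fun y : EuclideanSpace ℝ (Fin n) =>
      (EuclideanSpace.single i (1 : ℝ) : EuclideanSpace ℝ (Fin n)))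
      (fun y => EuclideanSpace.single j (1 : ℝ)) univ (e p) = 0 := by
    simp [VectorField.lieBracketWithin]
  exact (congrArg _ h0).trans (map_zero _)

end CoordinateFields

/-! ### Matrix calculus -/

section MatrixCalculus

variable {n : ℕ}

/-- The determinant as a continuous multilinear map of the rows. -/
def detMultilinear (n : ℕ) :
    ContinuousMultilinearMap ℝ (fun _ : Fin n => Fin n → ℝ) ℝ where
  toMultilinearMap := (Matrix.detRowAlternating (n := Fin n) (R := ℝ)).toMultilinearMap
  cont := Continuous.matrix_det (A := fun x : Fin n → Fin n → ℝ => Matrix.of x) continuous_id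

/-- The determinant is multilinear in the rows, so its derivative sums the determinants with one row
replaced by its derivative; by Cramer's rule each is a pairing with the adjugate. -/
lemma hasFDerivAt_det {E : Type*} [NormedAddCommGroup E] [NormedSpace ℝ E]
    {A : E → Matrix (Fin n) (Fin n) ℝ} {x : E}
    (hA : ∀ i j, DifferentiableAt ℝ (fun y => A y i j) x) (v : E) :
    DifferentiableAt ℝ (fun y => (A y).det) x ∧
    fderiv ℝ (fun y => (A y).det) x v =
      ∑ i, ∑ j, (A x).adjugate j i * fderiv ℝ (fun y => A y i j) x v := by
  have h1 : HasFDerivAt (fun y => (fun i j => A y i j : Fin n → Fin n → ℝ))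
      (ContinuousLinearMap.pi fun i => ContinuousLinearMap.pi fun j =>
        fderiv ℝ (fun y => A y i j) x) x := by
    refine hasFDerivAt_pi.2 fun i => hasFDerivAt_pi.2 fun j => (hA i j).hasFDerivAt
  have h2 := ((detMultilinear n).hasFDerivAt (x := fun i j => A x i j)).comp x h1
  have h3 : HasFDerivAt (fun y => (A y).det) _ x := h2
  refine ⟨h3.differentiableAt, ?_⟩
  rw [h3.fderiv, ContinuousLinearMap.comp_apply, ContinuousMultilinearMap.linearDeriv_apply]
  refine Finset.sum_congr rfl fun i _ => ?_
  have h4 := Matrix.cramer_transpose_apply (A x) (fun j => fderiv ℝ (fun y => A y i j) x v) i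
  refine Eq.trans h4.symm ?_
  rw [Matrix.cramer_eq_adjugate_mulVec, ← Matrix.adjugate_transpose]
  rfl

end MatrixCalculus

/-! ### Calculus of coordinate derivatives -/

section CoordDeriv

variable {n : ℕ} {M : Type*} [TopologicalSpace M] [ChartedSpace (EuclideanSpace ℝ (Fin n)) M]
  {e : OpenPartialHomeomorph M (EuclideanSpace ℝ (Fin n))} {p : M}

lemma coordDeriv_const (j : Fin n) (c : ℝ) : coordDeriv e j (fun _ => c) p = 0 := by
  simp [coordDeriv, mvfderiv_const]

lemma coordDeriv_mul (j : Fin n) {u v : M → ℝ} (hu : MDifferentiableAt (𝓡 n) 𝓘(ℝ, ℝ) u p)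
    (hv : MDifferentiableAt (𝓡 n) 𝓘(ℝ, ℝ) v p) :
    coordDeriv e j (fun q => u q * v q) p = u p * coordDeriv e j v p + coordDeriv e j u p * v p := by
  have := mvfderiv_fun_mul hu hv
  simp [coordDeriv, this, mul_comm]

lemma coordDeriv_sum (j : Fin n) {ι : Type} {s : Finset ι} {u : ι → M → ℝ}
    (hu : ∀ i ∈ s, MDifferentiableAt (𝓡 n) 𝓘(ℝ, ℝ) (u i) p) :
    coordDeriv e j (fun q => ∑ i ∈ s, u i q) p = ∑ i ∈ s, coordDeriv e j (u i) p := by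
  classical
  induction s using Finset.induction_on with
  | empty => simp [coordDeriv_const]
  | insert a s ha ih =>
    simp only [Finset.mem_insert, forall_eq_or_imp] at hu
    have hs : MDifferentiableAt (𝓡 n) 𝓘(ℝ, ℝ) (fun q => ∑ i ∈ s, u i q) p := by
      rw [← Finset.sum_fn]
      exact MDifferentiableAt.sum (I := 𝓡 n) (t := s) (f := u) (z := p) hu.2
    simp only [Finset.sum_insert ha, ← ih hu.2]
    have := mvfderiv_fun_add hu.1 hs
    simp [coordDeriv, this]

lemma coordDeriv_congr (j : Fin n) {u v : M → ℝ} (h : u =ᶠ[𝓝 p] v) :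
    coordDeriv e j u p = coordDeriv e j v p := by
  rw [coordDeriv, coordDeriv, mvfderiv, mvfderiv, h.mfderiv_eq, h.eq_of_nhds]

lemma differentiableAt_comp_chart_symm (he : e ∈ IsManifold.maximalAtlas (𝓡 n) ∞ M)
    (hp : p ∈ e.source) {u : M → ℝ} (hu : MDifferentiableAt (𝓡 n) 𝓘(ℝ, ℝ) u p) :
    DifferentiableAt ℝ (u ∘ e.symm) (e p) := by
  have hs : MDifferentiableAt (𝓡 n) (𝓡 n) e.symm (e p) :=
    (mdifferentiable_of_mem_maximalAtlas he).mdifferentiableAt_symm (e.map_source hp)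
  have hu' : MDifferentiableAt (𝓡 n) 𝓘(ℝ, ℝ) u (e.symm (e p)) := by rwa [e.left_inv hp]
  exact (hu'.comp _ hs).differentiableAt

/-- Jacobi's formula. -/
lemma coordDeriv_det (he : e ∈ IsManifold.maximalAtlas (𝓡 n) ∞ M) (hp : p ∈ e.source)
    {m : ℕ} {A : M → Matrix (Fin m) (Fin m) ℝ}
    (hA : ∀ i k, MDifferentiableAt (𝓡 n) 𝓘(ℝ, ℝ) (fun q => A q i k) p)
    (hdet : MDifferentiableAt (𝓡 n) 𝓘(ℝ, ℝ) (fun q => (A q).det) p) (j : Fin n) :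
    coordDeriv e j (fun q => (A q).det) p =
      ∑ i, ∑ k, (A p).adjugate k i * coordDeriv e j (fun q => A q i k) p := by
  rw [coordDeriv_eq_fderiv he hp hdet]
  refine (hasFDerivAt_det (A := fun y => A (e.symm y)) (fun i k =>
    differentiableAt_comp_chart_symm he hp (hA i k)) _).2.trans ?_
  simp only [e.left_inv hp]
  refine Finset.sum_congr rfl fun i _ => Finset.sum_congr rfl fun k _ => ?_
  rw [coordDeriv_eq_fderiv he hp (hA i k)]
  rfl

lemma coordDeriv_sqrt (he : e ∈ IsManifold.maximalAtlas (𝓡 n) ∞ M) (hp : p ∈ e.source)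
    {u : M → ℝ} (hu : MDifferentiableAt (𝓡 n) 𝓘(ℝ, ℝ) u p)
    (hsu : MDifferentiableAt (𝓡 n) 𝓘(ℝ, ℝ) (fun q => Real.sqrt (u q)) p)
    (h0 : u p ≠ 0) (j : Fin n) :
    coordDeriv e j (fun q => Real.sqrt (u q)) p = 1 / (2 * Real.sqrt (u p)) * coordDeriv e j u p := by
  rw [coordDeriv_eq_fderiv he hp hsu, coordDeriv_eq_fderiv he hp hu]
  have h1 : (u ∘ e.symm) (e p) ≠ 0 := by simpa [e.left_inv hp] using h0
  have h2 := ((differentiableAt_comp_chart_symm he hp hu).hasFDerivAt.sqrt h1).fderiv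
  have h3 : (fun q => Real.sqrt (u q)) ∘ e.symm = fun y => Real.sqrt ((u ∘ e.symm) y) := rfl
  rw [h3, h2]
  simp [e.left_inv hp]

lemma contMDiffAt_matrix_det {m : ℕ} {A : M → Matrix (Fin m) (Fin m) ℝ}
    (hA : ∀ i k, ContMDiffAt (𝓡 n) 𝓘(ℝ, ℝ) ∞ (fun q => A q i k) p) :
    ContMDiffAt (𝓡 n) 𝓘(ℝ, ℝ) ∞ (fun q => (A q).det) p := by
  simp only [Matrix.det_apply']
  exact contMDiffAt_finsetSum fun σ _ => contMDiffAt_const.mul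
    (contMDiffAt_finsetProd fun i _ => hA _ _)

/-- By Cramer's rule, an entry of the inverse is the determinant of a row-updated matrix divided by
`det A`. -/
lemma contMDiffAt_matrix_inv {m : ℕ} {A : M → Matrix (Fin m) (Fin m) ℝ}
    (hA : ∀ i k, ContMDiffAt (𝓡 n) 𝓘(ℝ, ℝ) ∞ (fun q => A q i k) p) (h0 : (A p).det ≠ 0)
    (i k : Fin m) : ContMDiffAt (𝓡 n) 𝓘(ℝ, ℝ) ∞ (fun q => (A q)⁻¹ i k) p := by
  simp only [Matrix.inv_def, Matrix.smul_apply, Matrix.adjugate_apply, Ring.inverse_eq_inv',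
    smul_eq_mul]
  refine ContMDiffAt.mul ((contMDiffAt_matrix_det hA).inv₀ h0) (contMDiffAt_matrix_det ?_)
  intro a b
  simp only [Matrix.updateRow_apply]
  split_ifs
  · exact contMDiffAt_const
  · exact hA a b

end CoordDeriv

/-! ### The metric in coordinates -/

section Metric

variable {n : ℕ} {M : Type*} [TopologicalSpace M] [ChartedSpace (EuclideanSpace ℝ (Fin n)) M]
  [RiemannianBundle (fun x : M => TangentSpace (𝓡 n) x)]
  {e : OpenPartialHomeomorph M (EuclideanSpace ℝ (Fin n))} {p : M}

lemma posDef_gramMatrix (he : e ∈ IsManifold.maximalAtlas (𝓡 n) ∞ M) (hp : p ∈ e.source) :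
    (gramMatrix e p).PosDef := by
  have h := (coordBasis he hp).linearIndependent
  have h1 : (fun i => coordBasis he hp i) = fun i => coordField e i p :=
    funext fun i => coordBasis_apply he hp i
  have h2 : LinearIndependent ℝ (fun i => coordField e i p) := h1 ▸ h
  exact Matrix.posDef_gram_of_linearIndependent h2

lemma det_gramMatrix_pos (he : e ∈ IsManifold.maximalAtlas (𝓡 n) ∞ M) (hp : p ∈ e.source) :
    0 < (gramMatrix e p).det := (posDef_gramMatrix he hp).det_pos

lemma sqrtDet_pos (he : e ∈ IsManifold.maximalAtlas (𝓡 n) ∞ M) (hp : p ∈ e.source) :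
    0 < sqrtDet e p := Real.sqrt_pos.2 (det_gramMatrix_pos he hp)

lemma gramMatrix_comm (e : OpenPartialHomeomorph M (EuclideanSpace ℝ (Fin n))) (p : M)
    (i j : Fin n) : gramMatrix e p i j = gramMatrix e p j i :=
  real_inner_comm (coordField e j p) (coordField e i p)

lemma inv_gramMatrix_comm (e : OpenPartialHomeomorph M (EuclideanSpace ℝ (Fin n))) (p : M)
    (i j : Fin n) : (gramMatrix e p)⁻¹ i j = (gramMatrix e p)⁻¹ j i := by
  have h : (gramMatrix e p).transpose = gramMatrix e p := by
    ext i j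
    exact gramMatrix_comm e p j i
  conv_lhs => rw [← h, ← Matrix.transpose_nonsing_inv]
  rfl

variable [IsManifold (𝓡 n) ∞ M] [IsContMDiffRiemannianBundle (𝓡 n) ∞ (EuclideanSpace ℝ (Fin n))
      (fun x : M => TangentSpace (𝓡 n) x)]

lemma contMDiffAt_gramMatrix (he : e ∈ IsManifold.maximalAtlas (𝓡 n) ∞ M) (hp : p ∈ e.source)
    (i j : Fin n) : ContMDiffAt (𝓡 n) 𝓘(ℝ, ℝ) ∞ (fun q => gramMatrix e q i j) p :=
  ContMDiffAt.inner_bundle (contMDiffAt_coordField he hp i) (contMDiffAt_coordField he hp j)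

lemma contMDiffAt_inv_gramMatrix (he : e ∈ IsManifold.maximalAtlas (𝓡 n) ∞ M)
    (hp : p ∈ e.source) (i j : Fin n) :
    ContMDiffAt (𝓡 n) 𝓘(ℝ, ℝ) ∞ (fun q => (gramMatrix e q)⁻¹ i j) p :=
  contMDiffAt_matrix_inv (contMDiffAt_gramMatrix he hp) (det_gramMatrix_pos he hp).ne' i j

lemma contMDiffAt_sqrtDet (he : e ∈ IsManifold.maximalAtlas (𝓡 n) ∞ M) (hp : p ∈ e.source) :
    ContMDiffAt (𝓡 n) 𝓘(ℝ, ℝ) ∞ (fun q => sqrtDet e q) p :=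
  (Real.contDiffAt_sqrt (det_gramMatrix_pos he hp).ne').contMDiffAt.comp p
    (contMDiffAt_matrix_det (contMDiffAt_gramMatrix he hp))

/-- `∂ⱼ √(det g) = ½ √(det g) g^{ab} ∂ⱼ g_{ab}`. -/
lemma coordDeriv_sqrtDet (he : e ∈ IsManifold.maximalAtlas (𝓡 n) ∞ M) (hp : p ∈ e.source)
    (j : Fin n) : coordDeriv e j (sqrtDet e) p = sqrtDet e p / 2 *
      ∑ a, ∑ b, (gramMatrix e p)⁻¹ a b * coordDeriv e j (fun q => gramMatrix e q a b) p := by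
  have hg := contMDiffAt_gramMatrix he hp
  have hdet := contMDiffAt_matrix_det hg
  have hpos := det_gramMatrix_pos he hp
  have h1 := coordDeriv_sqrt he hp (hdet.mdifferentiableAt (by simp))
    ((contMDiffAt_sqrtDet he hp).mdifferentiableAt (by simp)) hpos.ne' j
  have h2 := coordDeriv_det he hp (fun a b => (hg a b).mdifferentiableAt (by simp))
    (hdet.mdifferentiableAt (by simp)) j
  refine h1.trans ?_
  rw [h2]
  -- The adjugate in Jacobi's formula is `det g` times the inverse; writing `det g` as the square of
  -- `sqrtDet` cancels the denominator from the square root.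
  have h3 : ∀ a b, (gramMatrix e p).adjugate b a =
      (gramMatrix e p).det * (gramMatrix e p)⁻¹ a b := by
    intro a b
    rw [inv_gramMatrix_comm, Matrix.inv_def, Matrix.smul_apply, Ring.inverse_eq_inv', smul_eq_mul,
      mul_inv_cancel_left₀ hpos.ne']
  have h4 : (gramMatrix e p).det = sqrtDet e p * sqrtDet e p := (Real.mul_self_sqrt hpos.le).symm
  have h5 : Real.sqrt (gramMatrix e p).det = sqrtDet e p := rfl
  have h6 := (sqrtDet_pos he hp).ne'
  simp only [h3, mul_assoc, ← Finset.mul_sum]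
  rw [h5, h4]
  field_simp

/-- `∂ⱼ g^{ik} = - g^{ia} ∂ⱼ g_{ab} g^{bk}`. -/
lemma coordDeriv_inv_gramMatrix (he : e ∈ IsManifold.maximalAtlas (𝓡 n) ∞ M) (hp : p ∈ e.source)
    (j i k : Fin n) : coordDeriv e j (fun q => (gramMatrix e q)⁻¹ i k) p =
      -∑ a, ∑ b, (gramMatrix e p)⁻¹ i a * coordDeriv e j (fun q => gramMatrix e q a b) p *
        (gramMatrix e p)⁻¹ b k := by
  have hg : ∀ a b, MDifferentiableAt (𝓡 n) 𝓘(ℝ, ℝ) (fun q => gramMatrix e q a b) p :=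
    fun a b => (contMDiffAt_gramMatrix he hp a b).mdifferentiableAt (by simp)
  have hi : ∀ a b, MDifferentiableAt (𝓡 n) 𝓘(ℝ, ℝ) (fun q => (gramMatrix e q)⁻¹ a b) p :=
    fun a b => (contMDiffAt_inv_gramMatrix he hp a b).mdifferentiableAt (by simp)
  -- Differentiate `g g⁻¹ = 1`, which holds near `p`; multiplying by `g⁻¹` on the left then isolates
  -- the derivative of the inverse.
  have key : ∀ a, ∑ b, (gramMatrix e p a b * coordDeriv e j (fun q => (gramMatrix e q)⁻¹ b k) p +
      coordDeriv e j (fun q => gramMatrix e q a b) p * (gramMatrix e p)⁻¹ b k) = 0 := by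
    intro a
    have h1 : (fun q => ∑ b, gramMatrix e q a b * (gramMatrix e q)⁻¹ b k) =ᶠ[𝓝 p]
        fun _ => (1 : Matrix (Fin n) (Fin n) ℝ) a k := by
      filter_upwards [e.open_source.mem_nhds hp] with q hq
      rw [← Matrix.mul_apply, Matrix.mul_nonsing_inv _ (det_gramMatrix_pos he hq).ne'.isUnit]
    have h2 := coordDeriv_congr (e := e) j h1
    rw [coordDeriv_const, coordDeriv_sum (u := fun b q => gramMatrix e q a b * (gramMatrix e q)⁻¹ b k)
      j fun b _ => (hg a b).mul (hi b k)] at h2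
    rw [← h2]
    exact Finset.sum_congr rfl fun b _ => (coordDeriv_mul j (hg a b) (hi b k)).symm
  have hinv : (gramMatrix e p)⁻¹ * gramMatrix e p = 1 :=
    Matrix.nonsing_inv_mul _ (det_gramMatrix_pos he hp).ne'.isUnit
  have h3 : coordDeriv e j (fun q => (gramMatrix e q)⁻¹ i k) p =
      ∑ b, (∑ a, (gramMatrix e p)⁻¹ i a * gramMatrix e p a b) *
        coordDeriv e j (fun q => (gramMatrix e q)⁻¹ b k) p := by
    simp only [← Matrix.mul_apply, hinv, Matrix.one_apply, ite_mul, one_mul, zero_mul,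
      Finset.sum_ite_eq, Finset.mem_univ, if_true]
  have h4 : ∑ a, (gramMatrix e p)⁻¹ i a * ∑ b, (gramMatrix e p a b *
      coordDeriv e j (fun q => (gramMatrix e q)⁻¹ b k) p +
      coordDeriv e j (fun q => gramMatrix e q a b) p * (gramMatrix e p)⁻¹ b k) = 0 := by
    simp only [key, mul_zero, Finset.sum_const_zero]
  rw [h3, eq_neg_iff_add_eq_zero, ← h4]
  simp only [Finset.sum_add_distrib, mul_add, Finset.mul_sum, Finset.sum_mul, mul_assoc]
  rw [Finset.sum_comm]

end Metric

/-! ### Traces with respect to a non-orthonormal basis -/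

section Trace

variable {m : ℕ} {T W : Type*} [NormedAddCommGroup T] [InnerProductSpace ℝ T]
  [AddCommGroup W] [Module ℝ W]

/-- If `x` is the coordinate vector of `v`, its inner products with the basis form `G x`, so `G⁻¹`
recovers `x`. -/
lemma sum_inv_gram_smul (b : Module.Basis (Fin m) ℝ T) {G : Matrix (Fin m) (Fin m) ℝ}
    (hG : ∀ i j, G i j = inner ℝ (b i) (b j)) (hdet : IsUnit G.det) (v : T) :
    ∑ i, (∑ j, G⁻¹ i j * inner ℝ v (b j)) • b i = v := by
  have h1 : ∀ j, inner ℝ v (b j) = ∑ k, G j k * b.repr v k := by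
    intro j
    conv_lhs => rw [← b.sum_repr v, sum_inner]
    refine Finset.sum_congr rfl fun k _ => ?_
    rw [real_inner_smul_left, hG, real_inner_comm, mul_comm]
  have h2 : ∀ i, ∑ j, G⁻¹ i j * inner ℝ v (b j) = b.repr v i := by
    intro i
    simp only [h1]
    change (G⁻¹.mulVec (G.mulVec (b.repr v))) i = _
    rw [Matrix.mulVec_mulVec, Matrix.nonsing_inv_mul _ hdet, Matrix.one_mulVec]
  simp only [h2]
  exact b.sum_repr v

/-- The trace of a bilinear map, computed in an orthonormal basis and in an arbitrary basis. -/
lemma sum_orthonormalBasis_eq_sum_inv_gram {ι : Type*} [Fintype ι] (o : OrthonormalBasis ι ℝ T)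
    (b : Module.Basis (Fin m) ℝ T) {G : Matrix (Fin m) (Fin m) ℝ}
    (hG : ∀ i j, G i j = inner ℝ (b i) (b j)) (hdet : IsUnit G.det) (B : T →ₗ[ℝ] T →ₗ[ℝ] W) :
    ∑ k, B (o k) (o k) = ∑ i, ∑ j, G⁻¹ i j • B (b i) (b j) := by
  -- Expand only the first argument in the basis `b` and move the coefficient `⟨o k, b j⟩` into the
  -- second slot; summing over `k` there reassembles `b j`.
  have h1 : ∀ k, B (o k) (o k) =
      ∑ i, ∑ j, G⁻¹ i j • B (b i) ((inner ℝ (o k) (b j) : ℝ) • o k) := by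
    intro k
    have h := congrArg (fun v => B v (o k)) (sum_inv_gram_smul b hG hdet (o k))
    rw [← h]
    simp only [map_sum, map_smul, LinearMap.sum_apply, LinearMap.smul_apply, Finset.sum_smul,
      mul_smul]
  simp only [h1]
  rw [Finset.sum_comm]
  refine Finset.sum_congr rfl fun i _ => ?_
  rw [Finset.sum_comm]
  refine Finset.sum_congr rfl fun j _ => ?_
  rw [← Finset.smul_sum, ← map_sum, o.sum_repr' (b j)]

end Trace

/-! ### The contracted Christoffel symbols -/

section Christoffel

variable {n : ℕ} {M : Type*} [TopologicalSpace M] [ChartedSpace (EuclideanSpace ℝ (Fin n)) M]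
  [RiemannianBundle (fun x : M => TangentSpace (𝓡 n) x)]
  {e : OpenPartialHomeomorph M (EuclideanSpace ℝ (Fin n))} {p : M}

omit [TopologicalSpace M] [ChartedSpace (EuclideanSpace ℝ (Fin n)) M]
  [RiemannianBundle (fun x : M => TangentSpace (𝓡 n) x)] in
-- Here `K` stands for `g^{ij}` and `G a b c` for `⟨∇_a ∂_b, ∂_c⟩`. Of the two halves of `∂_j
-- g_{ab}` in the derivative of the inverse metric, one cancels the term from `√det g` after
-- relabelling; the other is the right-hand side.
lemma christoffel_contraction {K : Fin n → Fin n → ℝ} {G : Fin n → Fin n → Fin n → ℝ}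
    (hK : ∀ a b, K a b = K b a) (hsymm : ∀ a b c, G a b c = G b a c) (i : Fin n) :
    ∑ j, ((∑ a, ∑ b, K a b * G j a b) * K i j -
        ∑ a, ∑ b, K i a * (G j a b + G j b a) * K b j) =
      -∑ a, ∑ b, K a b * ∑ c, K i c * G b a c := by
  have h1 : ∑ j, ∑ a, ∑ b, K i a * G j b a * K b j =
      ∑ a, ∑ b, ∑ c, K a b * (K i c * G b a c) := by
    refine (Finset.sum_congr rfl fun j _ => Finset.sum_comm).trans (Finset.sum_comm.trans ?_)
    refine Finset.sum_congr rfl fun a _ => Finset.sum_congr rfl fun b _ =>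
      Finset.sum_congr rfl fun c _ => ?_
    ring
  have h2 : ∑ j, ∑ a, ∑ b, K i a * G j a b * K b j =
      ∑ j, ∑ a, ∑ b, K a b * G j a b * K i j := by
    rw [Finset.sum_comm]
    refine Finset.sum_congr rfl fun a _ => Finset.sum_congr rfl fun b _ =>
      Finset.sum_congr rfl fun c _ => ?_
    rw [hsymm, hK c b]
    ring
  simp only [Finset.sum_sub_distrib, mul_add, add_mul, Finset.sum_add_distrib, Finset.sum_mul,
    Finset.mul_sum, h1, h2]
  ring

lemma sum_inv_gramMatrix_smul (he : e ∈ IsManifold.maximalAtlas (𝓡 n) ∞ M) (hp : p ∈ e.source)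
    (v : TangentSpace (𝓡 n) p) :
    ∑ i, (∑ j, (gramMatrix e p)⁻¹ i j * inner ℝ v (coordField e j p)) • coordField e i p = v := by
  have h := sum_inv_gram_smul (coordBasis he hp) (G := gramMatrix e p)
    (fun i j => by simp only [coordBasis_apply]; rfl) (det_gramMatrix_pos he hp).ne'.isUnit v
  simpa only [coordBasis_apply] using h

lemma trace_eq_sum_inv_gramMatrix (he : e ∈ IsManifold.maximalAtlas (𝓡 n) ∞ M)
    (hp : p ∈ e.source) {W : Type*} [AddCommGroup W] [Module ℝ W]
    (B : TangentSpace (𝓡 n) p →ₗ[ℝ] TangentSpace (𝓡 n) p →ₗ[ℝ] W) :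
    ∑ k, B (stdOrthonormalBasis ℝ (TangentSpace (𝓡 n) p) k)
        (stdOrthonormalBasis ℝ (TangentSpace (𝓡 n) p) k) =
      ∑ i, ∑ j, (gramMatrix e p)⁻¹ i j • B (coordField e i p) (coordField e j p) := by
  have h := sum_orthonormalBasis_eq_sum_inv_gram (stdOrthonormalBasis ℝ (TangentSpace (𝓡 n) p))
    (coordBasis he hp) (G := gramMatrix e p)
    (fun i j => by simp only [coordBasis_apply]; rfl) (det_gramMatrix_pos he hp).ne'.isUnit B
  simpa only [coordBasis_apply] using h

variable [IsManifold (𝓡 n) ∞ M] [IsContMDiffRiemannianBundle (𝓡 n) ∞ (EuclideanSpace ℝ (Fin n))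
      (fun x : M => TangentSpace (𝓡 n) x)]

/-- `(1/√det g) ∂ⱼ(√det g g^{ij}) = - g^{ab} Γ_{ab}^i`, where `G a b c` are the Christoffel symbols
of the first kind. -/
lemma sum_coordDeriv_sqrtDet_mul_inv (he : e ∈ IsManifold.maximalAtlas (𝓡 n) ∞ M)
    (hp : p ∈ e.source) {G : Fin n → Fin n → Fin n → ℝ} (hsymm : ∀ a b c, G a b c = G b a c)
    (hG : ∀ j a b, coordDeriv e j (fun q => gramMatrix e q a b) p = G j a b + G j b a)
    (i : Fin n) :
    ∑ j, (1 / sqrtDet e p) *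
        coordDeriv e j (fun q => sqrtDet e q * (gramMatrix e q)⁻¹ i j) p =
      -∑ a, ∑ b, (gramMatrix e p)⁻¹ a b * ∑ c, (gramMatrix e p)⁻¹ i c * G b a c := by
  have h0 := (sqrtDet_pos he hp).ne'
  have hs := (contMDiffAt_sqrtDet he hp).mdifferentiableAt (n := ∞) (by simp)
  have hi : ∀ a b, MDifferentiableAt (𝓡 n) 𝓘(ℝ, ℝ) (fun q => (gramMatrix e q)⁻¹ a b) p :=
    fun a b => (contMDiffAt_inv_gramMatrix he hp a b).mdifferentiableAt (by simp)
  -- Both halves of `∂_j g_{ab}` contract equally with the symmetric inverse; the resulting 2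
  -- absorbs the ½ in `coordDeriv_sqrtDet`.
  have h1 : ∀ j, ∑ a, ∑ b, (gramMatrix e p)⁻¹ a b * (G j a b + G j b a) =
      2 * ∑ a, ∑ b, (gramMatrix e p)⁻¹ a b * G j a b := by
    intro j
    simp only [mul_add, Finset.sum_add_distrib, two_mul]
    congr 1
    rw [Finset.sum_comm]
    exact Finset.sum_congr rfl fun a _ => Finset.sum_congr rfl fun b _ => by
      rw [inv_gramMatrix_comm]
  have h2 : ∀ j, (1 / sqrtDet e p) *
      coordDeriv e j (fun q => sqrtDet e q * (gramMatrix e q)⁻¹ i j) p =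
      (∑ a, ∑ b, (gramMatrix e p)⁻¹ a b * G j a b) * (gramMatrix e p)⁻¹ i j
      - ∑ a, ∑ b, (gramMatrix e p)⁻¹ i a * (G j a b + G j b a) * (gramMatrix e p)⁻¹ b j := by
    intro j
    have h3 := coordDeriv_mul (e := e) j hs (hi i j)
    have h4 := coordDeriv_sqrtDet he hp j
    rw [h3, coordDeriv_inv_gramMatrix he hp, h4]
    simp only [hG, h1]
    field_simp
    ring
  simp only [h2]
  exact christoffel_contraction (inv_gramMatrix_comm e p) hsymm i


set_option synthInstance.maxHeartbeats 200000 in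
/-- `g^{ab} Γ_{ab} = - (1/√det g) ∂ⱼ(√det g g^{ij}) ∂ᵢ` for the Levi-Civita connection. -/
lemma sum_inv_gramMatrix_leviCivita
    {lc : CovariantDerivative (𝓡 n) (EuclideanSpace ℝ (Fin n)) (fun x : M => TangentSpace (𝓡 n) x)}
    (hlc : IsLeviCivita lc) (he : e ∈ IsManifold.maximalAtlas (𝓡 n) ∞ M) (hp : p ∈ e.source) :
    ∑ i, ∑ j, (gramMatrix e p)⁻¹ i j • lc (coordField e i) p (coordField e j p) =
      -∑ i, ∑ j, ((1 / sqrtDet e p) *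
        coordDeriv e j (fun q => sqrtDet e q * (gramMatrix e q)⁻¹ i j) p) • coordField e i p := by
  set G : Fin n → Fin n → Fin n → ℝ :=
    fun a b c => inner ℝ (lc (coordField e b) p (coordField e a p)) (coordField e c p) with hGdef
  have hd := fun k => mdifferentiableAt_coordField he hp k
  -- Symmetry in the first two indices comes from zero torsion and commuting coordinate fields; the
  -- expression for `∂_j g_{ab}` below comes from metric compatibility.
  have hsymm : ∀ a b c, G a b c = G b a c := by
    intro a b c
    have h := (CovariantDerivative.torsion_eq_zero_iff lc).1 hlc.1 (hd a) (hd b)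
    rw [mlieBracket_coordField he hp, sub_eq_zero] at h
    simp only [hGdef, h]
  have hG : ∀ j a b, coordDeriv e j (fun q => gramMatrix e q a b) p = G j a b + G j b a := by
    intro j a b
    have h := hlc.2.mvfderiv_inner_eq (coordField e j) (hd a) (hd b)
    refine h.trans ?_
    simp only [hGdef]
    rw [real_inner_comm (coordField e a p)]
  have h1 := fun i => sum_coordDeriv_sqrtDet_mul_inv he hp hsymm hG i
  simp only [← Finset.sum_smul, h1, neg_smul, Finset.sum_neg_distrib, neg_neg]
  have h2 : ∀ a b, lc (coordField e a) p (coordField e b p) =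
      ∑ i, (∑ c, (gramMatrix e p)⁻¹ i c * G b a c) • coordField e i p :=
    fun a b => (sum_inv_gramMatrix_smul he hp _).symm
  simp only [h2, Finset.smul_sum, Finset.sum_smul, smul_smul]
  conv_rhs => rw [Finset.sum_comm]
  refine Finset.sum_congr rfl fun a _ => ?_
  conv_rhs => rw [Finset.sum_comm]
  refine Finset.sum_congr rfl fun b _ => Finset.sum_congr rfl fun c _ => ?_
  simp only [Finset.mul_sum, Finset.sum_smul]

end Christoffel

/-! ### The codifferential -/

section Codifferential

variable {n : ℕ} {M : Type*} [TopologicalSpace M] [ChartedSpace (EuclideanSpace ℝ (Fin n)) M]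
  [IsManifold (𝓡 n) ∞ M]
  {F : Type*} [NormedAddCommGroup F] [NormedSpace ℝ F]
  {V : M → Type*} [TopologicalSpace (TotalSpace F V)]
  [∀ x, NormedAddCommGroup (V x)] [∀ x, InnerProductSpace ℝ (V x)] [FiberBundle F V]
  [VectorBundle ℝ F V]
  [RiemannianBundle (fun x : M => TangentSpace (𝓡 n) x)]

/-- The formal adjoint of a metric connection: minus the trace of the covariant derivative of a
one-form with values in `V`. -/
def codifferential (cov : CovariantDerivative (𝓡 n) F V)
    (lc : CovariantDerivative (𝓡 n) (EuclideanSpace ℝ (Fin n))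
      (fun x : M => TangentSpace (𝓡 n) x))
    (η : Π x : M, TangentSpace (𝓡 n) x →L[ℝ] V x) (p : M) : V p :=
  -∑ i, (cov (fun q => η q (FiberBundle.extend (EuclideanSpace ℝ (Fin n))
        (stdOrthonormalBasis ℝ (TangentSpace (𝓡 n) p) i) q)) p
        (stdOrthonormalBasis ℝ (TangentSpace (𝓡 n) p) i)
      - η p (lc (FiberBundle.extend (EuclideanSpace ℝ (Fin n))
        (stdOrthonormalBasis ℝ (TangentSpace (𝓡 n) p) i)) p
        (stdOrthonormalBasis ℝ (TangentSpace (𝓡 n) p) i)))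

/-- `η` is differentiable at `p` as a one-form with values in `V`. -/
abbrev MDiffOneFormAt (F : Type*) [NormedAddCommGroup F] [NormedSpace ℝ F]
    {V : M → Type*} [TopologicalSpace (TotalSpace F V)]
    [∀ x, NormedAddCommGroup (V x)] [∀ x, InnerProductSpace ℝ (V x)] [FiberBundle F V]
    [VectorBundle ℝ F V] (η : Π x : M, TangentSpace (𝓡 n) x →L[ℝ] V x) (p : M) : Prop :=
  MDifferentiableAt (𝓡 n) ((𝓡 n).prod 𝓘(ℝ, EuclideanSpace ℝ (Fin n) →L[ℝ] F))
    (fun x => TotalSpace.mk' (EuclideanSpace ℝ (Fin n) →L[ℝ] F)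
      (E := fun y : M => TangentSpace (𝓡 n) y →L[ℝ] V y) x (η x)) p

omit [RiemannianBundle (fun x : M => TangentSpace (𝓡 n) x)] in
/-- The covariant derivative of a one-form is tensorial. -/
lemma exists_covariantDerivative_oneForm (cov : CovariantDerivative (𝓡 n) F V)
    (lc : CovariantDerivative (𝓡 n) (EuclideanSpace ℝ (Fin n))
      (fun x : M => TangentSpace (𝓡 n) x))
    {η : Π x : M, TangentSpace (𝓡 n) x →L[ℝ] V x} {p : M} (hη : MDiffOneFormAt F η p) :
    ∃ B : TangentSpace (𝓡 n) p →ₗ[ℝ] TangentSpace (𝓡 n) p →ₗ[ℝ] V p,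
      ∀ (W : Π x : M, TangentSpace (𝓡 n) x),
        MDifferentiableAt (𝓡 n) ((𝓡 n).prod 𝓘(ℝ, EuclideanSpace ℝ (Fin n)))
          (fun q => TotalSpace.mk' (EuclideanSpace ℝ (Fin n)) q (W q)) p →
        ∀ u, B (W p) u = cov (fun q => η q (W q)) p u - η p (lc W p u) := by
  set Φ : (Π x : M, TangentSpace (𝓡 n) x) → (TangentSpace (𝓡 n) p →L[ℝ] V p) :=
    fun W => cov (fun q => η q (W q)) p - (η p).comp (lc W p) with hΦ
  -- Both `∇(ηW)` and `η(∇W)` produce the same Leibniz term when `W` is scaled by a function, so it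
  -- cancels in the difference.
  have hT : TensorialAt (𝓡 n) (EuclideanSpace ℝ (Fin n)) Φ p := by
    constructor
    · intro f W hf hW
      have h1 : MDifferentiableAt (𝓡 n) ((𝓡 n).prod 𝓘(ℝ, F))
          (fun q => TotalSpace.mk' F q (η q (W q))) p := MDifferentiableAt.clm_bundle_apply hη hW
      have h2 := cov.isCovariantDerivativeOn (s := univ) |>.leibniz h1 hf
      have h3 := lc.isCovariantDerivativeOn (s := univ) |>.leibniz hW hf
      have h4 : (fun q => η q ((f • W) q)) = f • fun q => η q (W q) := by
        ext q; simp
      simp only [hΦ]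
      rw [h4, h2, h3]
      ext u
      simp
      module
    · intro W W' hW hW'
      have h1 : MDifferentiableAt (𝓡 n) ((𝓡 n).prod 𝓘(ℝ, F))
          (fun q => TotalSpace.mk' F q (η q (W q))) p := MDifferentiableAt.clm_bundle_apply hη hW
      have h1' : MDifferentiableAt (𝓡 n) ((𝓡 n).prod 𝓘(ℝ, F))
          (fun q => TotalSpace.mk' F q (η q (W' q))) p := MDifferentiableAt.clm_bundle_apply hη hW'
      have h2 := cov.isCovariantDerivativeOn (s := univ) |>.add h1 h1'
      have h3 := lc.isCovariantDerivativeOn (s := univ) |>.add hW hW'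
      have h4 : (fun q => η q ((W + W') q)) = (fun q => η q (W q)) + fun q => η q (W' q) := by
        ext q; simp
      simp only [hΦ]
      rw [h4, h2, h3]
      ext u
      simp
      abel
  refine ⟨LinearMap.mk₂ ℝ (fun w u => TensorialAt.mkHom Φ p hT w u)
    (fun a b c => congrArg (fun L => L c) ((TensorialAt.mkHom Φ p hT).map_add a b))
    (fun a b c => congrArg (fun L => L c) ((TensorialAt.mkHom Φ p hT).map_smul a b))
    (fun a b c => (TensorialAt.mkHom Φ p hT a).map_add b c)
    (fun a b c => (TensorialAt.mkHom Φ p hT b).map_smul a c), fun W hW u => ?_⟩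
  rw [LinearMap.mk₂_apply, TensorialAt.mkHom_apply hT hW]
  rfl

variable [IsContMDiffRiemannianBundle (𝓡 n) ∞ (EuclideanSpace ℝ (Fin n))
      (fun x : M => TangentSpace (𝓡 n) x)]
  {e : OpenPartialHomeomorph M (EuclideanSpace ℝ (Fin n))} {p : M}

set_option synthInstance.maxHeartbeats 200000 in
/-- The codifferential in coordinates. -/
lemma codifferential_eq (cov : CovariantDerivative (𝓡 n) F V)
    {lc : CovariantDerivative (𝓡 n) (EuclideanSpace ℝ (Fin n)) (fun x : M => TangentSpace (𝓡 n) x)}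
    (hlc : IsLeviCivita lc) (he : e ∈ IsManifold.maximalAtlas (𝓡 n) ∞ M) (hp : p ∈ e.source)
    {η : Π x : M, TangentSpace (𝓡 n) x →L[ℝ] V x} (hη : MDiffOneFormAt F η p) :
    codifferential cov lc η p =
      -(∑ i, ∑ j, (gramMatrix e p)⁻¹ i j •
        cov (fun q => η q (coordField e i q)) p (coordField e j p))
      - ∑ i, ∑ j, ((1 / sqrtDet e p) *
        coordDeriv e j (fun q => sqrtDet e q * (gramMatrix e q)⁻¹ i j) p) •
          η p (coordField e i p) := by
  -- Tensoriality permits replacing the extended orthonormal basis by the coordinate fields. The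
  -- Levi-Civita term is then `η` applied to the contracted Christoffel symbols.
  obtain ⟨B, hB⟩ := exists_covariantDerivative_oneForm cov lc hη
  have h1 : codifferential cov lc η p =
      -∑ k, B (stdOrthonormalBasis ℝ (TangentSpace (𝓡 n) p) k)
        (stdOrthonormalBasis ℝ (TangentSpace (𝓡 n) p) k) := by
    rw [codifferential]
    congr 1
    refine Finset.sum_congr rfl fun k _ => ?_
    rw [← hB _ (FiberBundle.mdifferentiableAt_extend ..), FiberBundle.extend_apply_self]
  have h2 := congrArg (η p) (sum_inv_gramMatrix_leviCivita hlc he hp)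
  simp only [map_sum, map_neg, map_smul] at h2
  rw [h1, trace_eq_sum_inv_gramMatrix he hp]
  simp only [hB _ (mdifferentiableAt_coordField he hp _), smul_sub, Finset.sum_sub_distrib, h2]
  abel

end Codifferential

/-! ### The divergence identity and smoothness of the codifferential -/

section Divergence

variable {n : ℕ} {M : Type*} [TopologicalSpace M] [ChartedSpace (EuclideanSpace ℝ (Fin n)) M]
  [IsManifold (𝓡 n) ∞ M]
  {F : Type*} [NormedAddCommGroup F] [NormedSpace ℝ F]
  {V : M → Type*} [TopologicalSpace (TotalSpace F V)]
  [∀ x, NormedAddCommGroup (V x)] [∀ x, InnerProductSpace ℝ (V x)] [FiberBundle F V]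
  [VectorBundle ℝ F V]
  [RiemannianBundle (fun x : M => TangentSpace (𝓡 n) x)]
  {e : OpenPartialHomeomorph M (EuclideanSpace ℝ (Fin n))} {p : M}

omit [IsManifold (𝓡 n) ∞ M] [TopologicalSpace (TotalSpace F V)] [FiberBundle F V]
  [VectorBundle ℝ F V] in
lemma formInner_eq (he : e ∈ IsManifold.maximalAtlas (𝓡 n) ∞ M) (hp : p ∈ e.source)
    (A B : TangentSpace (𝓡 n) p →L[ℝ] V p) :
    formInner p A B = ∑ i, ∑ j, (gramMatrix e p)⁻¹ i j *
      inner ℝ (A (coordField e i p)) (B (coordField e j p)) := by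
  have h := trace_eq_sum_inv_gramMatrix he hp (W := ℝ)
    (LinearMap.mk₂ ℝ (fun u w => inner ℝ (A u) (B w))
      (fun a b c => by rw [A.map_add, inner_add_left])
      (fun a b c => by rw [A.map_smul, real_inner_smul_left, smul_eq_mul])
      (fun a b c => by rw [B.map_add, inner_add_right])
      (fun a b c => by rw [B.map_smul, real_inner_smul_right, smul_eq_mul]))
  simpa only [formInner, LinearMap.mk₂_apply, smul_eq_mul] using h

variable [IsContMDiffRiemannianBundle (𝓡 n) ∞ (EuclideanSpace ℝ (Fin n))
      (fun x : M => TangentSpace (𝓡 n) x)]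
  [FiniteDimensional ℝ F] [ContMDiffVectorBundle ∞ F V (𝓡 n)] [IsContMDiffRiemannianBundle (𝓡 n) ∞ F V]

/-- The components `√(det g) g^{ij} ⟨ηᵢ, Y⟩` of the vector density dual to `⟨η, Y⟩`. -/
def fluxDensity (e : OpenPartialHomeomorph M (EuclideanSpace ℝ (Fin n)))
    (η : Π x : M, TangentSpace (𝓡 n) x →L[ℝ] V x) (Y : Π x : M, V x) (j : Fin n) (q : M) : ℝ :=
  ∑ i, (sqrtDet e q * (gramMatrix e q)⁻¹ i j) * inner ℝ (η q (coordField e i q)) (Y q)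

set_option synthInstance.maxHeartbeats 200000 in
-- Metric compatibility splits the derivative of `⟨η_i, Y⟩` into a `∇Y` part, giving `formInner`,
-- and a part differentiating `η_i`. The latter, with the derivatives of `√det g g^{ij}`, is the
-- coordinate form of the codifferential.
lemma sum_coordDeriv_fluxDensity {cov : CovariantDerivative (𝓡 n) F V}
    (hmetric : cov.IsMetricCompatible)
    {lc : CovariantDerivative (𝓡 n) (EuclideanSpace ℝ (Fin n)) (fun x : M => TangentSpace (𝓡 n) x)}
    (hlc : IsLeviCivita lc) (he : e ∈ IsManifold.maximalAtlas (𝓡 n) ∞ M) (hp : p ∈ e.source)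
    {η : Π x : M, TangentSpace (𝓡 n) x →L[ℝ] V x} (hη : MDiffOneFormAt F η p)
    {Y : Π x : M, V x} (hY : MDifferentiableAt (𝓡 n) ((𝓡 n).prod 𝓘(ℝ, F))
      (fun q => TotalSpace.mk' F q (Y q)) p) :
    ∑ j, coordDeriv e j (fluxDensity e η Y j) p =
      sqrtDet e p * (formInner p (η p) (cov Y p) - inner ℝ (codifferential cov lc η p) (Y p)) := by
  have h0 := (sqrtDet_pos he hp).ne'
  have hc : ∀ i j, MDifferentiableAt (𝓡 n) 𝓘(ℝ, ℝ)
      (fun q => sqrtDet e q * (gramMatrix e q)⁻¹ i j) p := fun i j =>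
    ((contMDiffAt_sqrtDet he hp).mul (contMDiffAt_inv_gramMatrix he hp i j)).mdifferentiableAt
      (n := ∞) (by simp)
  have hηi : ∀ i, MDifferentiableAt (𝓡 n) ((𝓡 n).prod 𝓘(ℝ, F))
      (fun q => TotalSpace.mk' F q (η q (coordField e i q))) p := fun i =>
    MDifferentiableAt.clm_bundle_apply hη (mdifferentiableAt_coordField he hp i)
  have hin : ∀ i, MDifferentiableAt (𝓡 n) 𝓘(ℝ, ℝ)
      (fun q => (inner ℝ (η q (coordField e i q)) (Y q) : ℝ)) p := fun i => (hηi i).inner_bundle hY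
  have h1 : ∀ i j, coordDeriv e j (fun q => (inner ℝ (η q (coordField e i q)) (Y q) : ℝ)) p =
      inner ℝ (cov (fun q => η q (coordField e i q)) p (coordField e j p)) (Y p) +
      inner ℝ (η p (coordField e i p)) (cov Y p (coordField e j p)) := fun i j =>
    hmetric.mvfderiv_inner_eq (coordField e j) (hηi i) hY
  have h2 : ∀ j, coordDeriv e j (fluxDensity e η Y j) p =
      ∑ i, ((sqrtDet e p * (gramMatrix e p)⁻¹ i j) *
        (inner ℝ (cov (fun q => η q (coordField e i q)) p (coordField e j p)) (Y p) +
          inner ℝ (η p (coordField e i p)) (cov Y p (coordField e j p))) +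
        coordDeriv e j (fun q => sqrtDet e q * (gramMatrix e q)⁻¹ i j) p *
          inner ℝ (η p (coordField e i p)) (Y p)) := by
    intro j
    refine (coordDeriv_sum (u := fun i q => (sqrtDet e q * (gramMatrix e q)⁻¹ i j) *
      inner ℝ (η q (coordField e i q)) (Y q)) j fun i _ => (hc i j).mul (hin i)).trans ?_
    refine Finset.sum_congr rfl fun i _ => ?_
    rw [← h1, ← coordDeriv_mul j (hc i j) (hin i)]
  simp only [h2]
  rw [codifferential_eq cov hlc he hp hη, formInner_eq he hp, Finset.sum_comm]
  simp only [inner_sub_left, inner_neg_left, sum_inner, real_inner_smul_left, mul_sub, mul_neg,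
    Finset.mul_sum, mul_add, Finset.sum_add_distrib]
  have h3 : ∀ i j, sqrtDet e p * (1 / sqrtDet e p *
      (coordDeriv e j (fun q => sqrtDet e q * (gramMatrix e q)⁻¹ i j) p *
        inner ℝ (η p (coordField e i p)) (Y p))) =
      coordDeriv e j (fun q => sqrtDet e q * (gramMatrix e q)⁻¹ i j) p *
        inner ℝ (η p (coordField e i p)) (Y p) := by
    intro i j
    field_simp
  simp only [mul_assoc, h3]
  ring

end Divergence

/-! ### Smoothness of covariant derivatives and of the codifferential. -/

section Smoothness

variable {n : ℕ} {M : Type*} [TopologicalSpace M] [ChartedSpace (EuclideanSpace ℝ (Fin n)) M]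
  {e : OpenPartialHomeomorph M (EuclideanSpace ℝ (Fin n))} {p : M}

lemma contMDiffAt_coordDeriv (he : e ∈ IsManifold.maximalAtlas (𝓡 n) ∞ M) (hp : p ∈ e.source)
    {u : M → ℝ} (hu : ∀ q ∈ e.source, ContMDiffAt (𝓡 n) 𝓘(ℝ, ℝ) ∞ u q) (j : Fin n) :
    ContMDiffAt (𝓡 n) 𝓘(ℝ, ℝ) ∞ (fun q => coordDeriv e j u q) p := by
  have h1 : ContDiffAt ℝ ∞ (u ∘ e.symm) (e p) := by
    have h2 : ContMDiffAt (𝓡 n) 𝓘(ℝ, ℝ) ∞ u (e.symm (e p)) := by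
      rw [e.left_inv hp]; exact hu p hp
    exact (h2.comp (e p) (contMDiffAt_symm_of_mem_maximalAtlas he (e.map_source hp))).contDiffAt
  have h3 : ContDiffAt ℝ ∞ (fun y => fderiv ℝ (u ∘ e.symm) y (EuclideanSpace.single j 1)) (e p) :=
    (h1.fderiv_right (m := ∞) le_rfl).clm_apply contDiffAt_const
  have h4 := h3.contMDiffAt.comp p (contMDiffAt_of_mem_maximalAtlas he hp)
  refine h4.congr_of_eventuallyEq ?_
  filter_upwards [e.open_source.mem_nhds hp] with q hq
  exact coordDeriv_eq_fderiv he hq ((hu q hq).mdifferentiableAt (by simp)) j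

variable [IsManifold (𝓡 n) ∞ M] [T2Space M]
  {F : Type*} [NormedAddCommGroup F] [NormedSpace ℝ F]
  {V : M → Type*} [TopologicalSpace (TotalSpace F V)]
  [∀ x, NormedAddCommGroup (V x)] [∀ x, InnerProductSpace ℝ (V x)] [FiberBundle F V]
  [VectorBundle ℝ F V]

/-- The sections `η(∂_i)` are smooth only on a chart domain, so a bump function equal to 1 near `p`
first makes the section globally smooth. Locality of the connection shows that nothing changes near
`p`. -/
lemma contMDiffAt_covariantDerivative {cov : CovariantDerivative (𝓡 n) F V}
    (hsmooth : CovariantDerivative.ContMDiffCovariantDerivative cov ∞)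
    {σ : Π x : M, V x} {U : Set M} (hU : IsOpen U) (hp : p ∈ U)
    (hσ : ContMDiffOn (𝓡 n) ((𝓡 n).prod 𝓘(ℝ, F)) ∞ (fun x => TotalSpace.mk' F x (σ x)) U) :
    ContMDiffAt (𝓡 n) ((𝓡 n).prod 𝓘(ℝ, EuclideanSpace ℝ (Fin n) →L[ℝ] F)) ∞
      (fun x => TotalSpace.mk' (EuclideanSpace ℝ (Fin n) →L[ℝ] F)
        (E := fun y : M => TangentSpace (𝓡 n) y →L[ℝ] V y) x (cov σ x)) p := by
  obtain ⟨φ, -, hφ⟩ := (SmoothBumpFunction.nhds_basis_tsupport (I := 𝓡 n) p).mem_iff.1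
    (hU.mem_nhds hp)
  have h1 : ContMDiff (𝓡 n) ((𝓡 n).prod 𝓘(ℝ, F)) ∞
      (fun x => TotalSpace.mk' F x (((φ : M → ℝ) • σ) x)) :=
    ContMDiffOn.smul_section_of_tsupport φ.contMDiff.contMDiffOn hU hφ hσ
  have h2 := (hsmooth.contMDiff.contMDiff (σ := (φ : M → ℝ) • σ) (h1.contMDiffOn (s := univ))
    p (mem_univ p)).contMDiffAt univ_mem
  refine h2.congr_of_eventuallyEq ?_
  -- The derivative at `q` depends on the germ at `q`, so `φ = 1` is needed around each nearby `q`.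
  have h3 : ∀ᶠ q in 𝓝 p, (φ : M → ℝ) =ᶠ[𝓝 q] 1 := eventually_eventually_nhds.2 φ.eventuallyEq_one
  filter_upwards [hU.mem_nhds hp, h3] with q hq hq3
  have h4 : cov σ q = cov ((φ : M → ℝ) • σ) q :=
    (cov.isCovariantDerivativeOn (s := univ)).congr_of_eventuallyEq
      (((hσ q hq).contMDiffAt (hU.mem_nhds hq)).mdifferentiableAt (by simp))
      ((h1 q).mdifferentiableAt (by simp)) univ_mem
      (by filter_upwards [hq3] with x hx; simp [hx])
  rw [h4]

variable [RiemannianBundle (fun x : M => TangentSpace (𝓡 n) x)]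
  [IsContMDiffRiemannianBundle (𝓡 n) ∞ (EuclideanSpace ℝ (Fin n))
      (fun x : M => TangentSpace (𝓡 n) x)]

/-- The orthonormal bases in the definition are chosen separately at each point, without continuity;
the coordinate formula has smooth ingredients. -/
lemma smoothSection_codifferential {cov : CovariantDerivative (𝓡 n) F V}
    (hsmooth : CovariantDerivative.ContMDiffCovariantDerivative cov ∞)
    {lc : CovariantDerivative (𝓡 n) (EuclideanSpace ℝ (Fin n)) (fun x : M => TangentSpace (𝓡 n) x)}
    (hlc : IsLeviCivita lc)
    {η : Π x : M, TangentSpace (𝓡 n) x →L[ℝ] V x} (hη : SmoothOneForm (F := F) η) :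
    SmoothSection (n := n) (F := F) (codifferential cov lc η) := by
  intro p
  set e := chartAt (EuclideanSpace ℝ (Fin n)) p with he_def
  have he : e ∈ IsManifold.maximalAtlas (𝓡 n) ∞ M := IsManifold.chart_mem_maximalAtlas p
  have hp : p ∈ e.source := mem_chart_source _ p
  have hηi : ∀ i, ∀ q ∈ e.source, ContMDiffAt (𝓡 n) ((𝓡 n).prod 𝓘(ℝ, F)) ∞
      (fun q => TotalSpace.mk' F q (η q (coordField e i q))) q := fun i q hq =>
    ContMDiffAt.clm_bundle_apply (hη q) (contMDiffAt_coordField he hq i)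
  have h1 : ∀ i j, ContMDiffAt (𝓡 n) ((𝓡 n).prod 𝓘(ℝ, F)) ∞
      (fun q => TotalSpace.mk' F q
        (cov (fun q => η q (coordField e i q)) q (coordField e j q))) p := fun i j =>
    ContMDiffAt.clm_bundle_apply (contMDiffAt_covariantDerivative hsmooth e.open_source hp
      fun q hq => (hηi i q hq).contMDiffWithinAt) (contMDiffAt_coordField he hp j)
  have h2 : ∀ i j, ContMDiffAt (𝓡 n) 𝓘(ℝ, ℝ) ∞ (fun p => (1 / sqrtDet e p) *
        coordDeriv e j (fun q => sqrtDet e q * (gramMatrix e q)⁻¹ i j) p) p := by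
    intro i j
    simp only [one_div]
    exact ((contMDiffAt_sqrtDet he hp).inv₀ (sqrtDet_pos he hp).ne').mul
      (contMDiffAt_coordDeriv he hp (fun q hq => (contMDiffAt_sqrtDet he hq).mul
        (contMDiffAt_inv_gramMatrix he hq i j)) j)
  have h3 : ContMDiffAt (𝓡 n) ((𝓡 n).prod 𝓘(ℝ, F)) ∞ (fun q => TotalSpace.mk' F q
      ((-(fun p => ∑ i, ∑ j, (gramMatrix e p)⁻¹ i j •
        cov (fun q => η q (coordField e i q)) p (coordField e j p))
      - fun p => ∑ i, ∑ j, ((1 / sqrtDet e p) *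
        coordDeriv e j (fun q => sqrtDet e q * (gramMatrix e q)⁻¹ i j) p) •
          η p (coordField e i p) : Π x : M, V x) q)) p := by
    refine ContMDiffAt.sub_section (ContMDiffAt.neg_section ?_) ?_
    · exact ContMDiffAt.sum_section fun i _ => ContMDiffAt.sum_section fun j _ =>
        (contMDiffAt_inv_gramMatrix he hp i j).smul_section (h1 i j)
    · exact ContMDiffAt.sum_section fun i _ => ContMDiffAt.sum_section fun j _ =>
        (h2 i j).smul_section (hηi i p hp)
  refine h3.congr_of_eventuallyEq ?_
  filter_upwards [e.open_source.mem_nhds hp] with q hq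
  rw [codifferential_eq cov hlc he hq ((hη q).mdifferentiableAt (by simp))]
  rfl

end Smoothness

/-! ### The Riemannian measure -/

section Transition

variable {n : ℕ} {M : Type*} [TopologicalSpace M] [ChartedSpace (EuclideanSpace ℝ (Fin n)) M]
  {e e' : OpenPartialHomeomorph M (EuclideanSpace ℝ (Fin n))} {p : M}

lemma differentiableAt_transition (he : e ∈ IsManifold.maximalAtlas (𝓡 n) ∞ M)
    (he' : e' ∈ IsManifold.maximalAtlas (𝓡 n) ∞ M) (hp : p ∈ e.source) (hp' : p ∈ e'.source) :
    DifferentiableAt ℝ (e' ∘ e.symm) (e p) := by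
  have h1 := (mdifferentiable_of_mem_maximalAtlas he).mdifferentiableAt_symm (e.map_source hp)
  have h2 : MDifferentiableAt (𝓡 n) (𝓡 n) e' (e.symm (e p)) := by
    rw [e.left_inv hp]
    exact (mdifferentiable_of_mem_maximalAtlas he').mdifferentiableAt hp'
  exact (h2.comp _ h1).differentiableAt

lemma coordField_eq_sum (he : e ∈ IsManifold.maximalAtlas (𝓡 n) ∞ M)
    (he' : e' ∈ IsManifold.maximalAtlas (𝓡 n) ∞ M) (hp : p ∈ e.source) (hp' : p ∈ e'.source)
    (i : Fin n) : coordField e i p =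
      ∑ k, (fderiv ℝ (e' ∘ e.symm) (e p) (EuclideanSpace.single i 1)) k • coordField e' k p := by
  have hd := differentiableAt_transition he he' hp hp'
  have h1 : mfderiv (𝓡 n) (𝓡 n) e' p =
      (mfderiv (𝓡 n) (𝓡 n) (e' ∘ e.symm) (e p)).comp (mfderiv (𝓡 n) (𝓡 n) e p) := by
    rw [← mfderiv_comp p hd.mdifferentiableAt
      ((mdifferentiable_of_mem_maximalAtlas he).mdifferentiableAt hp)]
    refine Filter.EventuallyEq.mfderiv_eq ?_
    filter_upwards [e.open_source.mem_nhds hp] with q hq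
    simp [e.left_inv hq]
  apply (mdifferentiable_of_mem_maximalAtlas he').mfderiv_injective hp'
  have h2 : mfderiv (𝓡 n) (𝓡 n) e' p (coordField e i p) =
      fderiv ℝ (e' ∘ e.symm) (e p) (EuclideanSpace.single i 1) := by
    rw [h1, mfderiv_eq_fderiv]
    exact congrArg (fderiv ℝ (e' ∘ e.symm) (e p)) (mfderiv_coordField he hp i)
  refine h2.trans ?_
  rw [map_sum]
  simp only [map_smul, mfderiv_coordField he' hp']
  have h3 := (EuclideanSpace.basisFun (Fin n) ℝ).sum_repr
    (fderiv ℝ (e' ∘ e.symm) (e p) (EuclideanSpace.single i 1))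
  simp only [EuclideanSpace.basisFun_repr, EuclideanSpace.basisFun_apply] at h3
  exact h3.symm

variable [RiemannianBundle (fun x : M => TangentSpace (𝓡 n) x)]

/-- With `A` the Jacobian matrix of the transition map, `g = Aᵀ g' A`. The factor `|det A|` is the
one in the change of variables formula. -/
lemma sqrtDet_transition (he : e ∈ IsManifold.maximalAtlas (𝓡 n) ∞ M)
    (he' : e' ∈ IsManifold.maximalAtlas (𝓡 n) ∞ M) (hp : p ∈ e.source) (hp' : p ∈ e'.source) :
    sqrtDet e p = |(fderiv ℝ (e' ∘ e.symm) (e p)).det| * sqrtDet e' p := by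
  set L := fderiv ℝ (e' ∘ e.symm) (e p) with hL
  set A : Matrix (Fin n) (Fin n) ℝ := Matrix.of fun k i => (L (EuclideanSpace.single i 1)) k with hA
  have h1 : L.det = A.det := by
    have h2 := LinearMap.det_toMatrix (EuclideanSpace.basisFun (Fin n) ℝ).toBasis
      (L : EuclideanSpace ℝ (Fin n) →ₗ[ℝ] EuclideanSpace ℝ (Fin n))
    rw [ContinuousLinearMap.det, ← h2]
    congr 1
  have h3 : gramMatrix e p = A.transpose * gramMatrix e' p * A := by
    ext i j
    change inner ℝ (coordField e i p) (coordField e j p) = _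
    rw [coordField_eq_sum he he' hp hp' i, coordField_eq_sum he he' hp hp' j, sum_inner]
    simp only [inner_sum, real_inner_smul_left, real_inner_smul_right, Matrix.mul_apply,
      Finset.sum_mul]
    rw [Finset.sum_comm]
    refine Finset.sum_congr rfl fun a _ => Finset.sum_congr rfl fun b _ => ?_
    simp only [hA, Matrix.transpose_apply, Matrix.of_apply, gramMatrix]
    ring
  rw [h1, sqrtDet, sqrtDet, h3, Matrix.det_mul, Matrix.det_mul, Matrix.det_transpose,
    ← Real.sqrt_sq_eq_abs, ← Real.sqrt_mul (sq_nonneg _)]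
  congr 1
  ring

end Transition

/-! ### Agreement of chart measures on overlaps and their gluing. -/

section ChartMeasure

variable {n : ℕ} {M : Type*} [TopologicalSpace M] [ChartedSpace (EuclideanSpace ℝ (Fin n)) M]
  {e e' : OpenPartialHomeomorph M (EuclideanSpace ℝ (Fin n))}
  [MeasurableSpace M] [BorelSpace M]

omit [ChartedSpace (EuclideanSpace ℝ (Fin n)) M] in
-- Only the restriction of `e.symm` to the target is known to be continuous, so measurability is
-- obtained on the subtype and pushed forward.
lemma measurableSet_target_inter_preimage (e : OpenPartialHomeomorph M (EuclideanSpace ℝ (Fin n)))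
    {A : Set M} (hA : MeasurableSet A) : MeasurableSet (e.target ∩ e.symm ⁻¹' A) := by
  have h1 : Measurable (e.target.domRestrict e.symm) :=
    (continuousOn_iff_continuous_domRestrict.1 e.continuousOn_symm).measurable
  have h2 : e.target ∩ e.symm ⁻¹' A = Subtype.val '' (e.target.domRestrict e.symm ⁻¹' A) := by
    ext y
    simp only [mem_inter_iff, mem_preimage, mem_image, Subtype.exists, exists_and_right,
      exists_eq_right]
    exact ⟨fun h => ⟨h.1, h.2⟩, fun ⟨a, b⟩ => ⟨a, b⟩⟩
  rw [h2]
  exact (MeasurableEmbedding.subtype_coe e.open_target.measurableSet).measurableSet_image.2 (h1 hA)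

omit [ChartedSpace (EuclideanSpace ℝ (Fin n)) M] in
lemma aemeasurable_symm (e : OpenPartialHomeomorph M (EuclideanSpace ℝ (Fin n)))
    (w : EuclideanSpace ℝ (Fin n) → ℝ≥0∞) :
    AEMeasurable e.symm ((volume.restrict e.target).withDensity w) :=
  (e.continuousOn_symm.aemeasurable e.open_target.measurableSet).mono_ac
    (withDensity_absolutelyContinuous _ _)

variable [RiemannianBundle (fun x : M => TangentSpace (𝓡 n) x)] {f : M → ℝ}

lemma chartMeasure_apply (f : M → ℝ) (e : OpenPartialHomeomorph M (EuclideanSpace ℝ (Fin n)))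
    {A : Set M} (hA : MeasurableSet A) : chartMeasure f e A =
      ∫⁻ y in e.target ∩ e.symm ⁻¹' A,
        ENNReal.ofReal (Real.exp (-f (e.symm y)) * sqrtDet e (e.symm y)) := by
  have hm := measurableSet_target_inter_preimage e hA
  set w : EuclideanSpace ℝ (Fin n) → ℝ≥0∞ :=
    fun y => ENNReal.ofReal (Real.exp (-f (e.symm y)) * sqrtDet e (e.symm y)) with hw
  have h1 : (volume.restrict e.target).withDensity w (e.symm ⁻¹' A) =
      (volume.restrict e.target).withDensity w (e.target ∩ e.symm ⁻¹' A) := by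
    refine (measure_congr ?_).symm
    have h2 : ∀ᵐ y ∂((volume.restrict e.target).withDensity w), y ∈ e.target :=
      (withDensity_absolutelyContinuous _ w).ae_le (ae_restrict_mem e.open_target.measurableSet)
    filter_upwards [h2] with y hy
    exact propext ⟨fun h => h.2, fun h => ⟨hy, h⟩⟩
  rw [chartMeasure, Measure.map_apply_of_aemeasurable (aemeasurable_symm e w) hA, h1,
    withDensity_apply _ hm, Measure.restrict_restrict hm, inter_eq_left.2 inter_subset_left]

lemma chartMeasure_inter_source (f : M → ℝ)
    (e : OpenPartialHomeomorph M (EuclideanSpace ℝ (Fin n)))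
    {A : Set M} (hA : MeasurableSet A) :
    chartMeasure f e (A ∩ e.source) = chartMeasure f e A := by
  rw [chartMeasure_apply f e hA, chartMeasure_apply f e (hA.inter e.open_source.measurableSet)]
  congr 2
  ext y
  simp only [mem_inter_iff, mem_preimage]
  exact ⟨fun h => ⟨h.1, h.2.1⟩, fun h => ⟨h.1, h.2, e.map_target h.1⟩⟩

/-- Change of variables along `e' ∘ e.symm`, whose Jacobian is absorbed by `sqrtDet_transition`. -/
lemma chartMeasure_eq_of_subset (he : e ∈ IsManifold.maximalAtlas (𝓡 n) ∞ M)
    (he' : e' ∈ IsManifold.maximalAtlas (𝓡 n) ∞ M) {A : Set M} (hA : MeasurableSet A)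
    (h : A ⊆ e.source) (h' : A ⊆ e'.source) : chartMeasure f e A = chartMeasure f e' A := by
  have himg : e'.target ∩ e'.symm ⁻¹' A = (e' ∘ e.symm) '' (e.target ∩ e.symm ⁻¹' A) := by
    ext y
    constructor
    · rintro ⟨hy, hyA⟩
      refine ⟨e (e'.symm y), ⟨e.map_source (h hyA), ?_⟩, ?_⟩
      · simpa [e.left_inv (h hyA)] using hyA
      · simp [e.left_inv (h hyA), e'.right_inv hy]
    · rintro ⟨z, ⟨hz, hzA⟩, rfl⟩
      refine ⟨e'.map_source (h' hzA), ?_⟩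
      simpa [e'.left_inv (h' hzA)] using hzA
  rw [chartMeasure_apply f e hA, chartMeasure_apply f e' hA, himg,
    lintegral_image_eq_lintegral_abs_det_fderiv_mul volume
      (measurableSet_target_inter_preimage e hA) (f' := fderiv ℝ (e' ∘ e.symm))]
  · refine setLIntegral_congr_fun (measurableSet_target_inter_preimage e hA) ?_
    rintro y ⟨hy, hyA⟩
    have hs := sqrtDet_transition he he' (h hyA) (h' hyA)
    rw [e.right_inv hy] at hs
    simp only [Function.comp_apply, e'.left_inv (h' hyA)]
    rw [← ENNReal.ofReal_mul (abs_nonneg _), hs]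
    congr 1
    ring
  · rintro y ⟨hy, hyA⟩
    have hd := differentiableAt_transition he he' (h hyA) (h' hyA)
    rw [e.right_inv hy] at hd
    exact hd.hasFDerivAt.hasFDerivWithinAt
  · rintro y ⟨hy, hyA⟩ z ⟨hz, hzA⟩ hyz
    have h1 := e'.injOn (h' hyA) (h' hzA) hyz
    exact e.symm.injOn hy hz h1

variable [IsManifold (𝓡 n) ∞ M] [SecondCountableTopology M]

/-- On the domain of a chart the density measure is the measure of the chart. -/
lemma densityMeasure_apply (he : e ∈ IsManifold.maximalAtlas (𝓡 n) ∞ M)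
    {A : Set M} (hA : MeasurableSet A) (h : A ⊆ e.source) :
    densityMeasure n M f A = chartMeasure f e A := by
  refine le_antisymm ?_ ((le_iSup₂ (f := fun e (_ : e ∈ IsManifold.maximalAtlas (𝓡 n) ∞ M) =>
    chartMeasure f e) e he) A)
  rcases isEmpty_or_nonempty M with hM | hM
  · simp [Set.eq_empty_of_isEmpty A]
  obtain ⟨s, hs, hcov⟩ := TopologicalSpace.countable_cover_nhds
    (fun x : M => (chartAt (EuclideanSpace ℝ (Fin n)) x).open_source.mem_nhds (mem_chart_source _ x))
  have hsne : s.Nonempty := by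
    by_contra hne
    rw [not_nonempty_iff_eq_empty] at hne
    simp [hne] at hcov
    exact hM.elim fun x => (hcov.symm ▸ mem_univ x : x ∈ (∅ : Set M))
  obtain ⟨c, rfl⟩ := hs.exists_eq_range hsne
  set E : ℕ → OpenPartialHomeomorph M (EuclideanSpace ℝ (Fin n)) :=
    fun k => chartAt (EuclideanSpace ℝ (Fin n)) (c k) with hE
  have hEm : ∀ k, E k ∈ IsManifold.maximalAtlas (𝓡 n) ∞ M :=
    fun k => IsManifold.chart_mem_maximalAtlas _
  set S : ℕ → Set M := disjointed fun k => (E k).source with hS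
  have hSm : ∀ k, MeasurableSet (S k) :=
    MeasurableSet.disjointed fun k => (E k).open_source.measurableSet
  have hSsub : ∀ k, S k ⊆ (E k).source := fun k => disjointed_subset _ k
  have hSdisj : Pairwise (Function.onFun Disjoint S) := disjoint_disjointed _
  have hSun : ⋃ k, S k = univ := by
    rw [hS, iUnion_disjointed, ← hcov]
    simp [hE]
  have hsplit : ∀ (μ : Measure M) {B : Set M}, MeasurableSet B → μ B = ∑' k, μ (B ∩ S k) := by
    intro μ B hB
    rw [← measure_iUnion (fun i j hij => (hSdisj hij).mono inter_subset_right inter_subset_right)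
      fun k => hB.inter (hSm k), ← inter_iUnion, hSun, inter_univ]
  -- Countably many disjoint pieces, each inside a chart, carry a glued measure `ν`. It dominates
  -- every chart measure by agreement on overlaps, hence also their supremum, and inside `e.source`
  -- it is at most the measure of `e`.
  set ν : Measure M := Measure.sum fun k => (chartMeasure f (E k)).restrict (S k) with hν
  have hνB : ∀ {B : Set M}, MeasurableSet B → ν B = ∑' k, chartMeasure f (E k) (B ∩ S k) := by
    intro B hB
    rw [hν, Measure.sum_apply _ hB]
    exact tsum_congr fun k => Measure.restrict_apply hB
  have hle : densityMeasure n M f ≤ ν := by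
    refine iSup₂_le fun e₁ he₁ => Measure.le_iff.2 fun B hB => ?_
    rw [hsplit _ hB, hνB hB]
    refine ENNReal.tsum_le_tsum fun k => ?_
    rw [← chartMeasure_inter_source f e₁ (hB.inter (hSm k)),
      chartMeasure_eq_of_subset he₁ (hEm k) ((hB.inter (hSm k)).inter e₁.open_source.measurableSet)
        inter_subset_right (inter_subset_left.trans (inter_subset_right.trans (hSsub k)))]
    exact measure_mono inter_subset_left
  refine (hle A).trans ?_
  rw [hνB hA, hsplit (chartMeasure f e) hA]
  exact ENNReal.tsum_le_tsum fun k => (chartMeasure_eq_of_subset (hEm k) he (hA.inter (hSm k))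
    (inter_subset_right.trans (hSsub k)) (inter_subset_left.trans h)).le

lemma densityMeasure_restrict_source (he : e ∈ IsManifold.maximalAtlas (𝓡 n) ∞ M) :
    (densityMeasure n M f).restrict e.source = chartMeasure f e := by
  ext A hA
  rw [Measure.restrict_apply hA, densityMeasure_apply he
    (hA.inter e.open_source.measurableSet) inter_subset_right, chartMeasure_inter_source f e hA]

end ChartMeasure

/-! ### Local finiteness, positivity and chart integrals of the Riemannian measure. -/

section RiemannianMeasure

variable {n : ℕ} {M : Type*} [TopologicalSpace M] [ChartedSpace (EuclideanSpace ℝ (Fin n)) M]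
  {e : OpenPartialHomeomorph M (EuclideanSpace ℝ (Fin n))}
  [IsManifold (𝓡 n) ∞ M]
  [RiemannianBundle (fun x : M => TangentSpace (𝓡 n) x)]
  [IsContMDiffRiemannianBundle (𝓡 n) ∞ (EuclideanSpace ℝ (Fin n))
      (fun x : M => TangentSpace (𝓡 n) x)]

lemma continuousOn_sqrtDet_symm (he : e ∈ IsManifold.maximalAtlas (𝓡 n) ∞ M) :
    ContinuousOn (fun y => sqrtDet e (e.symm y)) e.target := fun _ hy =>
  ((contMDiffAt_sqrtDet he (e.map_target hy)).continuousAt.comp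
    (e.continuousAt_symm hy)).continuousWithinAt

variable [SecondCountableTopology M] [MeasurableSpace M] [BorelSpace M]

omit [IsContMDiffRiemannianBundle (𝓡 n) ∞ (EuclideanSpace ℝ (Fin n))
  (fun x : M => TangentSpace (𝓡 n) x)] in
lemma densityMeasure_zero_apply (he : e ∈ IsManifold.maximalAtlas (𝓡 n) ∞ M)
    {A : Set M} (hA : MeasurableSet A) (h : A ⊆ e.source) :
    densityMeasure n M (fun _ => 0) A =
      ∫⁻ y in e.target ∩ e.symm ⁻¹' A, ENNReal.ofReal (sqrtDet e (e.symm y)) := by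
  rw [densityMeasure_apply he hA h, chartMeasure_apply _ _ hA]
  simp

/-- The density is continuous, hence integrable on a compact coordinate ball. This makes compactly
supported continuous functions integrable. -/
instance isLocallyFiniteMeasure_densityMeasure :
    IsLocallyFiniteMeasure (densityMeasure n M (fun _ => 0)) := by
  refine ⟨fun p => ?_⟩
  set e := chartAt (EuclideanSpace ℝ (Fin n)) p with he_def
  have he : e ∈ IsManifold.maximalAtlas (𝓡 n) ∞ M := IsManifold.chart_mem_maximalAtlas p
  have hp : p ∈ e.source := mem_chart_source _ p
  obtain ⟨r, hr, hsub⟩ := Metric.nhds_basis_closedBall.mem_iff.1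
    (e.open_target.mem_nhds (e.map_source hp))
  have hopen : IsOpen (e.source ∩ e ⁻¹' Metric.ball (e p) r) :=
    e.isOpen_inter_preimage Metric.isOpen_ball
  refine ⟨_, hopen.mem_nhds ⟨hp, Metric.mem_ball_self hr⟩, ?_⟩
  rw [densityMeasure_zero_apply he hopen.measurableSet inter_subset_left]
  have h1 : IntegrableOn (fun y => sqrtDet e (e.symm y)) (Metric.closedBall (e p) r) :=
    ((continuousOn_sqrtDet_symm he).mono hsub).integrableOn_compact (isCompact_closedBall _ _)
  refine (lintegral_mono_set ?_).trans_lt h1.lintegral_lt_top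
  rintro y ⟨hy, hy2⟩
  have h2 := hy2.2
  rw [mem_preimage, e.right_inv hy] at h2
  exact Metric.ball_subset_closedBall h2

/-- The density is strictly positive in every chart. Uniqueness of the adjoint rests on this. -/
instance isOpenPosMeasure_densityMeasure :
    (densityMeasure n M (fun _ => 0)).IsOpenPosMeasure := by
  refine ⟨fun U hU ⟨p, hpU⟩ h0 => ?_⟩
  set e := chartAt (EuclideanSpace ℝ (Fin n)) p with he_def
  have he : e ∈ IsManifold.maximalAtlas (𝓡 n) ∞ M := IsManifold.chart_mem_maximalAtlas p
  have hp : p ∈ e.source := mem_chart_source _ p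
  have hA : IsOpen (U ∩ e.source) := hU.inter e.open_source
  have h1 := measure_mono_null (s := U ∩ e.source) inter_subset_left h0
  rw [densityMeasure_zero_apply he hA.measurableSet inter_subset_right] at h1
  have hO : IsOpen (e.target ∩ e.symm ⁻¹' (U ∩ e.source)) := e.isOpen_inter_preimage_symm hA
  have hm : AEMeasurable (fun y => ENNReal.ofReal (sqrtDet e (e.symm y)))
      (volume.restrict (e.target ∩ e.symm ⁻¹' (U ∩ e.source))) :=
    ENNReal.measurable_ofReal.comp_aemeasurable
      (((continuousOn_sqrtDet_symm he).mono inter_subset_left).aemeasurable hO.measurableSet)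
  rw [lintegral_eq_zero_iff' hm] at h1
  have h2 : ∀ᵐ y ∂(volume.restrict (e.target ∩ e.symm ⁻¹' (U ∩ e.source))), False := by
    filter_upwards [h1, ae_restrict_mem hO.measurableSet] with y hy hyO
    exact (ENNReal.ofReal_pos.2 (sqrtDet_pos he hyO.2.2)).ne' hy
  rw [ae_iff] at h2
  simp only [not_false_eq_true, ofPred_true, Measure.restrict_apply_univ] at h2
  exact (hO.measure_pos volume ⟨e p, e.map_source hp, by simp [e.left_inv hp, hpU, hp]⟩).ne' h2

lemma integral_densityMeasure_eq (he : e ∈ IsManifold.maximalAtlas (𝓡 n) ∞ M)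
    {h : M → ℝ} (hh : Continuous h) (h0 : ∀ x ∉ e.source, h x = 0) :
    ∫ x, h x ∂(densityMeasure n M (fun _ => 0)) =
      ∫ y in e.target, sqrtDet e (e.symm y) * h (e.symm y) := by
  have hm : AEMeasurable (fun y => ENNReal.ofReal
      (Real.exp (-(fun _ => 0 : M → ℝ) (e.symm y)) * sqrtDet e (e.symm y)))
      (volume.restrict e.target) := by
    simp only [neg_zero, Real.exp_zero, one_mul]
    exact ENNReal.measurable_ofReal.comp_aemeasurable
      ((continuousOn_sqrtDet_symm he).aemeasurable e.open_target.measurableSet)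
  rw [← setIntegral_eq_integral_of_forall_compl_eq_zero h0, densityMeasure_restrict_source he,
    chartMeasure, integral_map (aemeasurable_symm e _) hh.aestronglyMeasurable,
    integral_withDensity_eq_integral_toReal_smul₀ hm (by simp)]
  refine setIntegral_congr_fun e.open_target.measurableSet fun y hy => ?_
  simp [ENNReal.toReal_ofReal (sqrtDet_pos he (e.map_target hy)).le]

end RiemannianMeasure

/-! ### Integration by parts -/

/-- Integration by parts against the constant function 1. -/
lemma integral_fderiv_apply_eq_zero {E : Type*} [NormedAddCommGroup E] [NormedSpace ℝ E]
    [FiniteDimensional ℝ E] [MeasurableSpace E] [BorelSpace E] {μ : Measure E}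
    [μ.IsAddHaarMeasure] {u : E → ℝ} (hu : ContDiff ℝ 1 u) (hc : HasCompactSupport u) (v : E) :
    ∫ y, fderiv ℝ u y v ∂μ = 0 := by
  have h1 : Integrable (fun y => fderiv ℝ u y v) μ :=
    ((hu.continuous_fderiv one_ne_zero).clm_apply continuous_const).integrable_of_hasCompactSupport
      (hc.fderiv_apply ℝ v)
  have h := integral_bilinear_fderiv_right_eq_neg_left_of_integrable (μ := μ)
    (f := fun _ : E => (1 : ℝ)) (g := u) (v := v) (B := ContinuousLinearMap.mul ℝ ℝ)
    (by simp) (by simpa using h1)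
    (by simpa using hu.continuous.integrable_of_hasCompactSupport hc)
    (fun x _ => differentiableAt_const _)
    (fun x _ => hu.differentiable one_ne_zero x)
  simpa using h

section IntegrationByParts

variable {n : ℕ} {M : Type*} [TopologicalSpace M] [T2Space M]
  [ChartedSpace (EuclideanSpace ℝ (Fin n)) M] [IsManifold (𝓡 n) ∞ M]
  {e : OpenPartialHomeomorph M (EuclideanSpace ℝ (Fin n))} {p : M}
  {F : Type*} [NormedAddCommGroup F] [NormedSpace ℝ F]
  {V : M → Type*} [TopologicalSpace (TotalSpace F V)]
  [∀ x, NormedAddCommGroup (V x)] [∀ x, InnerProductSpace ℝ (V x)] [FiberBundle F V]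
  [VectorBundle ℝ F V]

lemma smoothOneForm_covariantDerivative {cov : CovariantDerivative (𝓡 n) F V}
    (hsmooth : CovariantDerivative.ContMDiffCovariantDerivative cov ∞)
    {Y : Π x : M, V x} (hY : SmoothSection (n := n) (F := F) Y) :
    SmoothOneForm (F := F) (cov Y) := fun p =>
  contMDiffAt_covariantDerivative hsmooth isOpen_univ (mem_univ p) hY.contMDiffOn

lemma covariantDerivative_eq_zero_of_notMem (cov : CovariantDerivative (𝓡 n) F V)
    {Y : Π x : M, V x} (hY : SmoothSection (n := n) (F := F) Y) {K : Set M} (hK : IsClosed K)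
    (h0 : ∀ x ∉ K, Y x = 0) {x : M} (hx : x ∉ K) : cov Y x = 0 := by
  have h1 : cov Y x = cov 0 x :=
    (cov.isCovariantDerivativeOn (s := univ)).congr_of_eventuallyEq
      ((hY x).mdifferentiableAt (by simp)) (mdifferentiableAt_zeroSection ..) univ_mem
      (by filter_upwards [hK.isOpen_compl.mem_nhds hx] with y hy; exact h0 y hy)
  rw [h1]
  exact (cov.isCovariantDerivativeOn (s := univ)).zero (mem_univ x)

variable [RiemannianBundle (fun x : M => TangentSpace (𝓡 n) x)]
  [IsContMDiffRiemannianBundle (𝓡 n) ∞ (EuclideanSpace ℝ (Fin n))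
      (fun x : M => TangentSpace (𝓡 n) x)]
  [ContMDiffVectorBundle ∞ F V (𝓡 n)] [IsContMDiffRiemannianBundle (𝓡 n) ∞ F V]

lemma continuous_formInner {A B : Π x : M, TangentSpace (𝓡 n) x →L[ℝ] V x}
    (hA : SmoothOneForm (F := F) A) (hB : SmoothOneForm (F := F) B) :
    Continuous fun x => formInner x (A x) (B x) := by
  refine continuous_iff_continuousAt.2 fun p => ?_
  set e := chartAt (EuclideanSpace ℝ (Fin n)) p with he_def
  have he : e ∈ IsManifold.maximalAtlas (𝓡 n) ∞ M := IsManifold.chart_mem_maximalAtlas p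
  have hp : p ∈ e.source := mem_chart_source _ p
  have h1 : ContinuousAt (fun q => ∑ i, ∑ j, (gramMatrix e q)⁻¹ i j *
      (inner ℝ (A q (coordField e i q)) (B q (coordField e j q)) : ℝ)) p := by
    refine tendsto_finsetSum _ fun i _ => tendsto_finsetSum _ fun j _ => ?_
    have hAi : ContMDiffAt (𝓡 n) ((𝓡 n).prod 𝓘(ℝ, F)) ∞
      (fun q => TotalSpace.mk' F q (A q (coordField e i q))) p :=
      ContMDiffAt.clm_bundle_apply (hA p) (contMDiffAt_coordField he hp i)
    have hBj : ContMDiffAt (𝓡 n) ((𝓡 n).prod 𝓘(ℝ, F)) ∞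
      (fun q => TotalSpace.mk' F q (B q (coordField e j q))) p :=
      ContMDiffAt.clm_bundle_apply (hB p) (contMDiffAt_coordField he hp j)
    exact (contMDiffAt_inv_gramMatrix he hp i j).continuousAt.mul (hAi.inner_bundle hBj).continuousAt
  refine h1.congr ?_
  filter_upwards [e.open_source.mem_nhds hp] with q hq
  rw [formInner_eq he hq]

omit [T2Space M] [IsContMDiffRiemannianBundle (𝓡 n) ∞ (EuclideanSpace ℝ (Fin n))
  (fun x : M => TangentSpace (𝓡 n) x)] [RiemannianBundle (fun x : M => TangentSpace (𝓡 n) x)] in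
lemma continuous_inner_section {σ τ : Π x : M, V x} (hσ : SmoothSection (n := n) (F := F) σ)
    (hτ : SmoothSection (n := n) (F := F) τ) : Continuous fun x => (inner ℝ (σ x) (τ x) : ℝ) :=
  (ContMDiff.inner_bundle hσ hτ).continuous

lemma contMDiffAt_fluxDensity (he : e ∈ IsManifold.maximalAtlas (𝓡 n) ∞ M) (hp : p ∈ e.source)
    {η : Π x : M, TangentSpace (𝓡 n) x →L[ℝ] V x} (hη : SmoothOneForm (F := F) η)
    {Y : Π x : M, V x} (hY : SmoothSection (n := n) (F := F) Y) (j : Fin n) :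
    ContMDiffAt (𝓡 n) 𝓘(ℝ, ℝ) ∞ (fluxDensity e η Y j) p := by
  have hηi : ∀ i, ContMDiffAt (𝓡 n) ((𝓡 n).prod 𝓘(ℝ, F)) ∞
      (fun q => TotalSpace.mk' F q (η q (coordField e i q))) p := fun i =>
    ContMDiffAt.clm_bundle_apply (hη p) (contMDiffAt_coordField he hp i)
  exact contMDiffAt_finsetSum fun i _ => ((contMDiffAt_sqrtDet he hp).mul
    (contMDiffAt_inv_gramMatrix he hp i j)).mul ((hηi i).inner_bundle (hY p))

/-- Since `Y` vanishes off a compact subset of the chart, each flux component extends by zero to a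
compactly supported `C¹` function on `ℝⁿ`, whose partial derivatives integrate to zero. -/
lemma integral_coordDeriv_fluxDensity (he : e ∈ IsManifold.maximalAtlas (𝓡 n) ∞ M)
    {η : Π x : M, TangentSpace (𝓡 n) x →L[ℝ] V x} (hη : SmoothOneForm (F := F) η)
    {Y : Π x : M, V x} (hY : SmoothSection (n := n) (F := F) Y) {K : Set M} (hK : IsCompact K)
    (hKe : K ⊆ e.source) (h0 : ∀ x ∉ K, Y x = 0) :
    ∫ y in e.target, ∑ j, coordDeriv e j (fluxDensity e η Y j) (e.symm y) = 0 := by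
  have hK' : IsCompact (e '' K) := hK.image_of_continuousOn (e.continuousOn.mono hKe)
  set u : Fin n → EuclideanSpace ℝ (Fin n) → ℝ :=
    fun j => e.target.indicator (fluxDensity e η Y j ∘ e.symm) with hu
  have hoff : ∀ j, ∀ y ∉ e '' K, u j y = 0 := by
    intro j y hy
    by_cases hyt : y ∈ e.target
    · have h1 : e.symm y ∉ K := fun h => hy ⟨_, h, e.right_inv hyt⟩
      simp [hu, indicator_of_mem hyt, fluxDensity, h0 _ h1]
    · exact indicator_of_notMem hyt _
  have hon : ∀ j, ∀ y ∈ e.target, u j =ᶠ[𝓝 y] fluxDensity e η Y j ∘ e.symm := by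
    intro j y hy
    filter_upwards [e.open_target.mem_nhds hy] with z hz
    exact indicator_of_mem hz _
  have hsupp : ∀ j, HasCompactSupport (u j) := fun j => HasCompactSupport.intro hK' (hoff j)
  have hsmooth : ∀ j, ContDiff ℝ 1 (u j) := by
    intro j
    refine contDiff_iff_contDiffAt.2 fun y => ?_
    by_cases hyt : y ∈ e.target
    · have h2 : ContMDiffAt (𝓡 n) 𝓘(ℝ, ℝ) ∞ (fluxDensity e η Y j) (e.symm y) :=
        contMDiffAt_fluxDensity he (e.map_target hyt) hη hY j
      have h3 := (h2.comp y (contMDiffAt_symm_of_mem_maximalAtlas he hyt)).contDiffAt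
      exact (h3.of_le (by simp)).congr_of_eventuallyEq (hon j y hyt)
    · have hy : y ∉ e '' K := by
        rintro ⟨x, hx, rfl⟩
        exact hyt (e.map_source (hKe hx))
      refine contDiffAt_const.congr_of_eventuallyEq (f := fun _ => 0) ?_
      filter_upwards [hK'.isClosed.isOpen_compl.mem_nhds hy] with z hz
      exact hoff j z hz
  have h1 : ∀ y ∈ e.target, ∑ j, coordDeriv e j (fluxDensity e η Y j) (e.symm y) =
      ∑ j, fderiv ℝ (u j) y (EuclideanSpace.single j 1) := by
    intro y hy
    refine Finset.sum_congr rfl fun j _ => ?_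
    rw [coordDeriv_eq_fderiv he (e.map_target hy) ((contMDiffAt_fluxDensity he (e.map_target hy)
      hη hY j).mdifferentiableAt (by simp)), e.right_inv hy, (hon j y hy).fderiv_eq]
  rw [setIntegral_congr_fun e.open_target.measurableSet h1,
    setIntegral_eq_integral_of_forall_compl_eq_zero, integral_finsetSum]
  · exact Finset.sum_eq_zero fun j _ => integral_fderiv_apply_eq_zero (hsmooth j) (hsupp j) _
  · exact fun j _ => (((hsmooth j).continuous_fderiv one_ne_zero).clm_apply
      continuous_const).integrable_of_hasCompactSupport ((hsupp j).fderiv_apply ℝ _)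
  · intro y hy
    refine Finset.sum_eq_zero fun j _ => ?_
    have hy' : y ∉ e '' K := by
      rintro ⟨x, hx, rfl⟩
      exact hy (e.map_source (hKe hx))
    have h2 : u j =ᶠ[𝓝 y] fun _ => 0 := by
      filter_upwards [hK'.isClosed.isOpen_compl.mem_nhds hy'] with z hz
      exact hoff j z hz
    rw [h2.fderiv_eq]
    simp

variable [SecondCountableTopology M] [MeasurableSpace M] [BorelSpace M] [FiniteDimensional ℝ F]

set_option synthInstance.maxHeartbeats 200000 in
lemma continuous_divergence {cov : CovariantDerivative (𝓡 n) F V}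
    (hsmooth : CovariantDerivative.ContMDiffCovariantDerivative cov ∞)
    {lc : CovariantDerivative (𝓡 n) (EuclideanSpace ℝ (Fin n)) (fun x : M => TangentSpace (𝓡 n) x)}
    (hlc : IsLeviCivita lc)
    {η : Π x : M, TangentSpace (𝓡 n) x →L[ℝ] V x} (hη : SmoothOneForm (F := F) η)
    {Y : Π x : M, V x} (hY : SmoothSection (n := n) (F := F) Y) :
    Continuous fun x =>
      formInner x (η x) (cov Y x) - inner ℝ (codifferential cov lc η x) (Y x) :=
  (continuous_formInner hη (smoothOneForm_covariantDerivative hsmooth hY)).sub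
    (continuous_inner_section (smoothSection_codifferential hsmooth hlc hη) hY)

set_option synthInstance.maxHeartbeats 200000 in
lemma integral_divergence_of_subset_source {cov : CovariantDerivative (𝓡 n) F V}
    (hsmooth : CovariantDerivative.ContMDiffCovariantDerivative cov ∞)
    (hmetric : cov.IsMetricCompatible)
    {lc : CovariantDerivative (𝓡 n) (EuclideanSpace ℝ (Fin n)) (fun x : M => TangentSpace (𝓡 n) x)}
    (hlc : IsLeviCivita lc) (he : e ∈ IsManifold.maximalAtlas (𝓡 n) ∞ M)
    {η : Π x : M, TangentSpace (𝓡 n) x →L[ℝ] V x} (hη : SmoothOneForm (F := F) η)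
    {Y : Π x : M, V x} (hY : SmoothSection (n := n) (F := F) Y) {K : Set M} (hK : IsCompact K)
    (hKe : K ⊆ e.source) (h0 : ∀ x ∉ K, Y x = 0) :
    ∫ x, (formInner x (η x) (cov Y x) - inner ℝ (codifferential cov lc η x) (Y x))
      ∂(densityMeasure n M fun _ => 0) = 0 := by
  rw [integral_densityMeasure_eq he (continuous_divergence hsmooth hlc hη hY)]
  · rw [← integral_coordDeriv_fluxDensity he hη hY hK hKe h0]
    refine setIntegral_congr_fun e.open_target.measurableSet fun y hy => ?_
    exact (sum_coordDeriv_fluxDensity hmetric hlc he (e.map_target hy)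
      ((hη _).mdifferentiableAt (by simp)) ((hY _).mdifferentiableAt (by simp))).symm
  · intro x hx
    have hxK : x ∉ K := fun h => hx (hKe h)
    rw [covariantDerivative_eq_zero_of_notMem cov hY hK.isClosed h0 hxK, h0 x hxK]
    simp [formInner]

end IntegrationByParts

/-! ### Existence and uniqueness of the formal adjoint; self-duality. -/

section FormalAdjoint

variable {n : ℕ} {M : Type*} [TopologicalSpace M] [T2Space M]
  [ChartedSpace (EuclideanSpace ℝ (Fin n)) M] [IsManifold (𝓡 n) ∞ M]
  {F : Type*} [NormedAddCommGroup F] [NormedSpace ℝ F]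
  {V : M → Type*} [TopologicalSpace (TotalSpace F V)]
  [∀ x, NormedAddCommGroup (V x)] [∀ x, InnerProductSpace ℝ (V x)] [FiberBundle F V]
  [VectorBundle ℝ F V]
  [RiemannianBundle (fun x : M => TangentSpace (𝓡 n) x)]
  [IsContMDiffRiemannianBundle (𝓡 n) ∞ (EuclideanSpace ℝ (Fin n))
      (fun x : M => TangentSpace (𝓡 n) x)]
  [ContMDiffVectorBundle ∞ F V (𝓡 n)] [IsContMDiffRiemannianBundle (𝓡 n) ∞ F V]
  [SecondCountableTopology M] [MeasurableSpace M] [BorelSpace M] [FiniteDimensional ℝ F]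

set_option synthInstance.maxHeartbeats 200000 in
/-- The divergence theorem for compactly supported sections. -/
lemma integral_divergence {cov : CovariantDerivative (𝓡 n) F V}
    (hsmooth : CovariantDerivative.ContMDiffCovariantDerivative cov ∞)
    (hmetric : cov.IsMetricCompatible)
    {lc : CovariantDerivative (𝓡 n) (EuclideanSpace ℝ (Fin n)) (fun x : M => TangentSpace (𝓡 n) x)}
    (hlc : IsLeviCivita lc)
    {η : Π x : M, TangentSpace (𝓡 n) x →L[ℝ] V x} (hη : SmoothOneForm (F := F) η)
    {Y : Π x : M, V x} (hY : SmoothSection (n := n) (F := F) Y) {K : Set M} (hK : IsCompact K)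
    (h0 : ∀ x ∉ K, Y x = 0) :
    ∫ x, (formInner x (η x) (cov Y x) - inner ℝ (codifferential cov lc η x) (Y x))
      ∂(densityMeasure n M fun _ => 0) = 0 := by
  have : LocallyCompactSpace M := ChartedSpace.locallyCompactSpace (EuclideanSpace ℝ (Fin n)) M
  obtain ⟨ρ, hρ⟩ := SmoothPartitionOfUnity.exists_isSubordinate_chartAt_source (𝓡 n) M
  have hfin := ρ.locallyFinite.finite_nonempty_inter_compact hK
  -- Only `Y` is decomposed, since the integrand is additive in it. By local finiteness, finitely
  -- many pieces meet `K`.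
  set Z : M → Π x : M, V x := fun i x => ρ i x • Y x with hZ
  have hZs : ∀ i, SmoothSection (n := n) (F := F) (Z i) := fun i =>
    ContMDiff.smul_section (ρ i).contMDiff hY
  have hYZ : Y = ∑ i ∈ hfin.toFinset, Z i := by
    funext x
    rw [Finset.sum_apply]
    by_cases hx : x ∈ K
    · have h1 : ∑ i ∈ hfin.toFinset, ρ i x = 1 := by
        rw [← finsum_eq_sum_of_support_subset]
        · exact ρ.sum_eq_one (mem_univ x)
        · intro i hi
          simp only [Finite.coe_toFinset]
          exact ⟨x, hi, hx⟩
      simp only [hZ, ← Finset.sum_smul, h1, one_smul]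
    · simp [hZ, h0 x hx]
  -- Smoothness of the partial sums is carried through the induction because the connection is
  -- additive only on differentiable sections.
  have key : ∀ s : Finset M, SmoothSection (n := n) (F := F) (∑ i ∈ s, Z i) ∧
      ∫ x, (formInner x (η x) (cov (∑ i ∈ s, Z i) x) -
        inner ℝ (codifferential cov lc η x) ((∑ i ∈ s, Z i) x))
      ∂(densityMeasure n M fun _ => 0) = 0 := by
    intro s
    have hint : ∀ {W : Π x : M, V x}, SmoothSection (n := n) (F := F) W → (∀ x ∉ K, W x = 0) →
        Integrable (fun x => formInner x (η x) (cov W x) -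
          inner ℝ (codifferential cov lc η x) (W x)) (densityMeasure n M fun _ => 0) := by
      intro W hW hW0
      refine (continuous_divergence hsmooth hlc hη hW).integrable_of_hasCompactSupport
        (HasCompactSupport.intro hK fun x hx => ?_)
      rw [covariantDerivative_eq_zero_of_notMem cov hW hK.isClosed hW0 hx, hW0 x hx]
      simp [formInner]
    have hZ0 : ∀ i, ∀ x ∉ K, Z i x = 0 := fun i x hx => by simp [hZ, h0 x hx]
    induction s using Finset.cons_induction with
    | empty =>
      refine ⟨by rw [Finset.sum_empty]; exact contMDiff_zeroSection ℝ V, ?_⟩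
      have h1 : cov (0 : Π x : M, V x) = 0 := by
        funext x
        exact (cov.isCovariantDerivativeOn (s := univ)).zero (mem_univ x)
      simp [h1, formInner]
    | cons i s hi ih =>
      have hs := ih.1
      rw [Finset.sum_cons]
      refine ⟨ContMDiff.add_section (hZs i) hs, ?_⟩
      have h1 : ∀ x, cov (Z i + ∑ i ∈ s, Z i) x = cov (Z i) x + cov (∑ i ∈ s, Z i) x := fun x =>
        (cov.isCovariantDerivativeOn (s := univ)).add ((hZs i x).mdifferentiableAt (by simp))
          ((hs x).mdifferentiableAt (by simp)) (mem_univ x)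
      have h2 : ∀ x, formInner x (η x) (cov (Z i + ∑ i ∈ s, Z i) x) -
          inner ℝ (codifferential cov lc η x) ((Z i + ∑ i ∈ s, Z i) x) =
          (formInner x (η x) (cov (Z i) x) - inner ℝ (codifferential cov lc η x) (Z i x)) +
          (formInner x (η x) (cov (∑ i ∈ s, Z i) x) -
            inner ℝ (codifferential cov lc η x) ((∑ i ∈ s, Z i) x)) := by
        intro x
        rw [h1 x, Pi.add_apply, inner_add_right]
        simp only [formInner, add_apply, inner_add_right,
          Finset.sum_add_distrib]
        ring
      simp only [h2]
      rw [integral_add (hint (hZs i) (hZ0 i)) (hint hs fun x hx => by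
        rw [Finset.sum_apply]; exact Finset.sum_eq_zero fun i _ => hZ0 i x hx), ih.2, add_zero]
      refine integral_divergence_of_subset_source hsmooth hmetric hlc
        (IsManifold.chart_mem_maximalAtlas i) hη (hZs i)
        (hK.inter_right (isClosed_tsupport (ρ i))) (inter_subset_right.trans (hρ i)) ?_
      intro x hx
      by_cases hxK : x ∈ K
      · have : ρ i x = 0 := image_eq_zero_of_notMem_tsupport fun h => hx ⟨hxK, h⟩
        simp [hZ, this]
      · exact hZ0 i x hxK
  have h := (key hfin.toFinset).2
  rwa [← hYZ] at h

set_option synthInstance.maxHeartbeats 200000 in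
lemma isFormalAdjoint_codifferential {cov : CovariantDerivative (𝓡 n) F V}
    (hsmooth : CovariantDerivative.ContMDiffCovariantDerivative cov ∞)
    (hmetric : cov.IsMetricCompatible)
    {lc : CovariantDerivative (𝓡 n) (EuclideanSpace ℝ (Fin n)) (fun x : M => TangentSpace (𝓡 n) x)}
    (hlc : IsLeviCivita lc) :
    IsFormalAdjoint (fun _ => 0) cov (codifferential cov lc) where
  smooth η hη := smoothSection_codifferential hsmooth hlc hη
  adjoint η hη Y hY := by
    rintro ⟨K, hK, h0⟩
    have h := integral_divergence hsmooth hmetric hlc hη hY hK h0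
    rw [integral_sub, sub_eq_zero] at h
    · exact h
    · refine (continuous_formInner hη
        (smoothOneForm_covariantDerivative hsmooth hY)).integrable_of_hasCompactSupport
        (HasCompactSupport.intro hK fun x hx => ?_)
      rw [covariantDerivative_eq_zero_of_notMem cov hY hK.isClosed h0 hx]
      simp [formInner]
    · exact (continuous_inner_section (smoothSection_codifferential hsmooth hlc hη)
        hY).integrable_of_hasCompactSupport
        (HasCompactSupport.intro hK fun x hx => by simp [h0 x hx])

omit [FiniteDimensional ℝ F] in
/-- The formal adjoint is unique on smooth forms. -/
lemma IsFormalAdjoint.eq {cov : CovariantDerivative (𝓡 n) F V}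
    {D D' : (Π x : M, TangentSpace (𝓡 n) x →L[ℝ] V x) → Π x : M, V x}
    (hD : IsFormalAdjoint (fun _ => 0) cov D) (hD' : IsFormalAdjoint (fun _ => 0) cov D')
    {η : Π x : M, TangentSpace (𝓡 n) x →L[ℝ] V x} (hη : SmoothOneForm (F := F) η) :
    D η = D' η := by
  have : LocallyCompactSpace M := ChartedSpace.locallyCompactSpace (EuclideanSpace ℝ (Fin n)) M
  funext p
  by_contra hne
  -- Testing with `φ • τ`, where `τ = D η - D' η`, forces the integral of `φ |τ|²` to vanish,
  -- although this function is continuous, nonnegative and positive at `p`.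
  let φ : SmoothBumpFunction (𝓡 n) p := Classical.arbitrary _
  set τ : Π x : M, V x := D η - D' η with hτ
  have hτs : SmoothSection (n := n) (F := F) τ :=
    ContMDiff.sub_section (hD.smooth η hη) (hD'.smooth η hη)
  have hYs : SmoothSection (n := n) (F := F) (fun x => φ x • τ x) :=
    ContMDiff.smul_section φ.contMDiff hτs
  have h0 : ∀ x ∉ tsupport φ, φ x • τ x = 0 := fun x hx => by
    rw [image_eq_zero_of_notMem_tsupport hx, zero_smul]
  have hK : IsCompact (tsupport φ) := φ.hasCompactSupport
  have h1 := (hD.adjoint η hη _ hYs ⟨_, hK, h0⟩).symm.trans (hD'.adjoint η hη _ hYs ⟨_, hK, h0⟩)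
  have hint : ∀ {σ : Π x : M, V x}, SmoothSection (n := n) (F := F) σ →
      Integrable (fun x => (inner ℝ (σ x) (φ x • τ x) : ℝ)) (densityMeasure n M fun _ => 0) :=
    fun hσ => (continuous_inner_section hσ hYs).integrable_of_hasCompactSupport
      (HasCompactSupport.intro hK fun x hx => by rw [h0 x hx, inner_zero_right])
  rw [← sub_eq_zero, ← integral_sub (hint (hD.smooth η hη)) (hint (hD'.smooth η hη))] at h1
  simp only [← inner_sub_left] at h1
  have h2 : 0 < ∫ x, (inner ℝ (τ x) (φ x • τ x) : ℝ) ∂(densityMeasure n M fun _ => 0) := by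
    refine (continuous_inner_section hτs hYs).integral_pos_of_hasCompactSupport_nonneg_nonzero
      (HasCompactSupport.intro hK fun x hx => by rw [h0 x hx, inner_zero_right]) ?_ (x := p) ?_
    · intro x
      change 0 ≤ (inner ℝ (τ x) (φ x • τ x) : ℝ)
      rw [real_inner_smul_right]
      exact mul_nonneg φ.nonneg real_inner_self_nonneg
    · rw [φ.eq_one, one_smul]
      exact inner_self_ne_zero.2 (sub_ne_zero.2 hne)
  exact h2.ne' h1

omit [T2Space M] [RiemannianBundle (fun x : M => TangentSpace (𝓡 n) x)]
  [IsContMDiffRiemannianBundle (𝓡 n) ∞ (EuclideanSpace ℝ (Fin n))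
    (fun x : M => TangentSpace (𝓡 n) x)]
  [SecondCountableTopology M] [MeasurableSpace M] [BorelSpace M] in
/-- A metric connection is its own dual. -/
lemma IsDual.eq {cov cov' : CovariantDerivative (𝓡 n) F V} (hdual : IsDual cov cov')
    (hmetric : cov.IsMetricCompatible) {σ : Π x : M, V x} {x : M}
    (hσ : MDifferentiableAt (𝓡 n) ((𝓡 n).prod 𝓘(ℝ, F)) (fun y => TotalSpace.mk' F y (σ y)) x) :
    cov' σ x = cov σ x := by
  ext X
  -- Extend `v` to a local section and differentiate its product with `σ` by both rules: the term
  -- differentiating the extension is common and cancels.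
  refine ext_inner_left ℝ fun v => ?_
  have hv : MDifferentiableAt (𝓡 n) ((𝓡 n).prod 𝓘(ℝ, F))
      (fun y => TotalSpace.mk' F y (FiberBundle.extend F v y)) x :=
    FiberBundle.mdifferentiableAt_extend ..
  have h1 := hdual x X (FiberBundle.extend F v) σ hv hσ
  have h2 := hmetric.mvfderiv_inner_eq
    (FiberBundle.extend (EuclideanSpace ℝ (Fin n)) X) hv hσ
  simp only [FiberBundle.extend_apply_self] at h1 h2
  have h3 := h1.symm.trans h2
  exact add_left_cancel h3

end FormalAdjoint

end BochnerLaplacian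

end

/-! ### The Bochner Laplacian of a metric connection. -/

theorem mainTheorem3 {n : ℕ} {M : Type*} [TopologicalSpace M] [T2Space M]
    [SecondCountableTopology M] [MeasurableSpace M] [BorelSpace M]
    [ChartedSpace (EuclideanSpace ℝ (Fin n)) M] [IsManifold (𝓡 n) ∞ M]
    [RiemannianBundle (fun x : M => TangentSpace (𝓡 n) x)]
    [IsContMDiffRiemannianBundle (𝓡 n) ∞ (EuclideanSpace ℝ (Fin n))
      (fun x : M => TangentSpace (𝓡 n) x)]
    {F : Type*} [NormedAddCommGroup F] [NormedSpace ℝ F] [FiniteDimensional ℝ F]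
    {V : M → Type*} [TopologicalSpace (TotalSpace F V)]
    [∀ x, NormedAddCommGroup (V x)] [∀ x, InnerProductSpace ℝ (V x)]
    [FiberBundle F V] [VectorBundle ℝ F V] [ContMDiffVectorBundle ∞ F V (𝓡 n)]
    [IsContMDiffRiemannianBundle (𝓡 n) ∞ F V]
    (f : M → ℝ) (cov cov' : CovariantDerivative (𝓡 n) F V)
    (hsmooth : CovariantDerivative.ContMDiffCovariantDerivative cov ∞)
    (hdual : BochnerLaplacian.IsDual cov cov')
    (hmetric : cov.IsMetricCompatible) (hf : ∀ x, f x = 0)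
    (lc : CovariantDerivative (𝓡 n) (EuclideanSpace ℝ (Fin n))
      (fun x : M => TangentSpace (𝓡 n) x))
    (hlc : BochnerLaplacian.IsLeviCivita lc) :
    ((∀ (σ : Π x : M, V x) (x : M),
        MDifferentiableAt (𝓡 n) ((𝓡 n).prod 𝓘(ℝ, F)) (fun y => TotalSpace.mk' F y (σ y)) x →
        cov' σ x = cov σ x) ∧
      cov'.difference cov = 0) ∧
    (∃ D, BochnerLaplacian.IsFormalAdjoint f cov D) ∧
    ∀ D, BochnerLaplacian.IsFormalAdjoint f cov D →
      ∀ X : Π x : M, V x, BochnerLaplacian.SmoothSection (n := n) (F := F) X → ∀ p : M,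
        (∀ e ∈ IsManifold.maximalAtlas (𝓡 n) ∞ M, p ∈ e.source →
          D (cov X) p = BochnerLaplacian.coordFormula f cov cov' e X p) ∧
        D (cov X) p = BochnerLaplacian.connectionLaplacian cov lc X p := by
  obtain rfl : f = fun _ => 0 := funext hf
  have hcov : ∀ (σ : Π x : M, V x) (x : M),
      MDifferentiableAt (𝓡 n) ((𝓡 n).prod 𝓘(ℝ, F)) (fun y => TotalSpace.mk' F y (σ y)) x →
      cov' σ x = cov σ x := fun σ x hσ => hdual.eq hmetric hσ
  refine ⟨⟨hcov, ?_⟩, ⟨_, BochnerLaplacian.isFormalAdjoint_codifferential hsmooth hmetric hlc⟩,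
    fun D hD X hX p => ?_⟩
  · funext x
    ext v u
    have hv : MDifferentiableAt (𝓡 n) ((𝓡 n).prod 𝓘(ℝ, F))
        (fun y => TotalSpace.mk' F y (FiberBundle.extend F v y)) x :=
      FiberBundle.mdifferentiableAt_extend ..
    have h := IsCovariantDerivativeOn.difference_apply (cov'.isCovariantDerivativeOn (s := univ))
      (cov.isCovariantDerivativeOn (s := univ)) (mem_univ x) hv
    rw [hcov _ x hv, sub_self, FiberBundle.extend_apply_self] at h
    exact congrArg (fun L => L u) h
  · have hη := BochnerLaplacian.smoothOneForm_covariantDerivative hsmooth hX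
    have hD' : D (cov X) = BochnerLaplacian.codifferential cov lc (cov X) := hD.eq
      (BochnerLaplacian.isFormalAdjoint_codifferential hsmooth hmetric hlc) hη
    rw [hD']
    -- The codifferential of `cov X` unfolds to the connection Laplacian.
    refine ⟨fun e he hp => ?_, rfl⟩
    -- The connections are known to agree only on differentiable sections, so differentiability of
    -- `∇_i X` at `p` must be supplied.
    have h1 : ∀ i, cov' (fun q => cov X q (BochnerLaplacian.coordField e i q)) p =
        cov (fun q => cov X q (BochnerLaplacian.coordField e i q)) p := fun i =>
      hcov _ p (MDifferentiableAt.clm_bundle_apply ((hη p).mdifferentiableAt (by simp))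
        (BochnerLaplacian.mdifferentiableAt_coordField he hp i))
    rw [BochnerLaplacian.codifferential_eq cov hlc he hp ((hη p).mdifferentiableAt (by simp)),
      BochnerLaplacian.coordFormula]
    simp only [h1, BochnerLaplacian.coordDeriv_const, mul_zero, zero_smul, Finset.sum_const_zero,
      add_zero]
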